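/- Let $N\ge 2$, let $\omega\subset\mathbb R^{N-1}$ be a smooth bounded domain, and put $\Sigma_\omega=\omega\times(0,\infty)$, $\Omega_\omega=\omega\times(0,1)$, $\Gamma_0=\omega\times\{1\}$, $\Gamma=\partial\Omega_\omega\setminus\overline{\Gamma_0}$. Let $H_0^1(\Omega_\omega\cup\Gamma)$ be the space of functions in $H^1(\Omega_\omega)$ whose trace vanishes on $\Gamma_0$, and let $H^1_{0,x_N}(\Omega_\omega\cup\Gamma)$ be its subspace of functions depending only on the last variable $x_N$. Let $f$ be of class $C^{1,\alpha}$ on $\mathbb R$ for some $\alpha\in(0,1)$ (that is, $f\in C^1(\mathbb R)$ and $f'$ is $\alpha$-Hölder continuous on bounded intervals), with $$f'(s)>\frac{f(s)}{s}\quad\text{and}\quad s f(s)>0\qquad\text{for all } s\neq 0 .$$ Let $u_\omega\in H_0^1(\Omega_\omega\cup\Gamma)$ be a one-dimensional weak solution of $$-\Delta u=f(u)\ \text{ in }\Omega_\omega,\qquad u=0\ \text{ on }\Gamma_0,\qquad \frac{\partial u}{\partial\nu}=0\ \text{ on }\Gamma ,$$ that is, $\int_{\Omega_\omega}\nabla u_\omega\cdot\nabla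 v\,dx=\int_{\Omega_\omega}f(u_\omega)v\,dx$ for all $v\in H_0^1(\Omega_\omega\cup\Gamma)$ and $u_\omega(x',x_N)=\widetilde u(x_N)$ for a function $\widetilde u$ on $(0,1)$; $u_\omega$ is identified with its continuous representative. Suppose that $u_\omega$ has exactly $n$ nodal domains, where $1\le n<\infty$; that is, $\Omega_\omega\setminus\{u_\omega=0\}$ has exactly $n$ connected components. Then the one-dimensional Morse index of $u_\omega$, i.e. the number of negative eigenvalues (counted with multiplicity) of the linearized operator $L_{u_\omega}=-\Delta-f'(u_\omega)$ in $H^1_{0,x_N}(\Omega_\omega\cup\Gamma)$, satisfies $$m^{x_N}(u_\omega)=n .$$ Moreover, the eigenvalue problem $$-z''-f'(\widetilde u)z=az\ \text{ in }(0,1),\qquad z'(0)=z(1)=0,$$ has exactly $n$ negative eigenvalues $a$. -/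

import Mathlib

open MeasureTheory Set

noncomputable section

namespace OneDimMorse

/-- Points `x = (x', x_N)` of `ℝ^N`, with `x' ∈ ℝ^d`, `d = N - 1`, and `x_N ∈ ℝ`. The measure is the
product (Lebesgue) measure. The norm of this product type is used only up to equivalence. -/
abbrev Space (d : ℕ) : Type := EuclideanSpace ℝ (Fin d) × ℝ

variable {d : ℕ}

/-- The Euclidean scalar product of `ℝ^N = ℝ^d × ℝ`. -/
def dot (a b : Space d) : ℝ := inner ℝ a.1 b.1 + a.2 * b.2

/-- A smooth bounded domain of `ℝ^d`: a nonempty connected bounded open set which near each of its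
boundary points is the sublevel set of a smooth function with nonvanishing differential. -/
structure IsSmoothBoundedDomain (ω : Set (EuclideanSpace ℝ (Fin d))) : Prop where
  isOpen : IsOpen ω
  isConnected : IsConnected ω
  isBounded : Bornology.IsBounded ω
  smooth_boundary : ∀ p ∈ frontier ω, ∃ (V : Set (EuclideanSpace ℝ (Fin d)))
    (ρ : EuclideanSpace ℝ (Fin d) → ℝ), IsOpen V ∧ p ∈ V ∧ ContDiffOn ℝ (⊤ : ℕ∞) ρ V ∧
      fderiv ℝ ρ p ≠ 0 ∧ ω ∩ V = {x ∈ V | ρ x < 0}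

/-- The half-cylinder `Σ_ω = ω × (0, ∞)`. -/
def halfCylinder (ω : Set (EuclideanSpace ℝ (Fin d))) : Set (Space d) := ω ×ˢ Ioi 0

/-- The bounded cylinder `Ω_ω = ω × (0, 1)`. -/
def cylinder (ω : Set (EuclideanSpace ℝ (Fin d))) : Set (Space d) := ω ×ˢ Ioo 0 1

/-- `f ∈ C^{1,α}(ℝ)`: `f` is continuously differentiable and `f'` is `α`-Hölder continuous on
bounded intervals. -/
def IsC1Holder (α : NNReal) (f : ℝ → ℝ) : Prop :=
  ContDiff ℝ 1 f ∧ ∀ R : ℝ, ∃ C : NNReal, HolderOnWith C α (deriv f) (Icc (-R) R)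

/-- Test functions in `C_c^∞(U)`. -/
structure IsTest (U : Set (Space d)) (φ : Space d → ℝ) : Prop where
  smooth : ContDiff ℝ (⊤ : ℕ∞) φ
  compact : HasCompactSupport φ
  subset : tsupport φ ⊆ U

/-- `g` is the weak gradient of `v` in `U`. -/
def IsWeakGradient (U : Set (Space d)) (v : Space d → ℝ) (g : Space d → Space d) : Prop :=
  ∀ φ, IsTest U φ → ∀ e : Space d,
    ∫ x in U, v x * fderiv ℝ φ x e = - ∫ x in U, dot (g x) e * φ x

/-- `t` is the trace on `Γ₀ = ω × {1}` of the function `v ∈ H¹(Ω_ω)` with weak gradient `g`, that is,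
Green's formula holds with boundary values `t` for all test functions in `C_c^∞(Σ_ω)` (these
vanish near the rest of the boundary of `Ω_ω`, and are arbitrary on `Γ₀`). -/
def HasTrace (ω : Set (EuclideanSpace ℝ (Fin d))) (v : Space d → ℝ) (g : Space d → Space d)
    (t : EuclideanSpace ℝ (Fin d) → ℝ) : Prop :=
  MemLp t 2 (volume.restrict ω) ∧ ∀ φ, IsTest (halfCylinder ω) φ →
    ∫ x in cylinder ω, v x * fderiv ℝ φ x (0, 1) =
      (∫ y in ω, t y * φ (y, 1)) - ∫ x in cylinder ω, (g x).2 * φ x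

/-- `v` belongs to `H_0^1(Ω_ω ∪ Γ)`, the space of the functions of `H¹(Ω_ω)` whose trace vanishes on
`Γ₀`, and its weak gradient is `g`. -/
structure InH10 (ω : Set (EuclideanSpace ℝ (Fin d))) (v : Space d → ℝ) (g : Space d → Space d) :
    Prop where
  memLp : MemLp v 2 (volume.restrict (cylinder ω))
  memLp_grad : MemLp g 2 (volume.restrict (cylinder ω))
  weakGradient : IsWeakGradient (cylinder ω) v g
  trace : HasTrace ω v g 0

/-- `v` depends (almost everywhere) only on `x_N` in `Ω_ω`. -/
def IsOneDim (ω : Set (EuclideanSpace ℝ (Fin d))) (v : Space d → ℝ) : Prop :=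
  ∃ V : ℝ → ℝ, ∀ᵐ x ∂(volume.restrict (cylinder ω)), v x = V x.2

/-- `u ∈ H_0^1(Ω_ω ∪ Γ)` is a weak solution of `-Δu = f(u)` in `Ω_ω`, `u = 0` on `Γ₀`,
`∂u/∂ν = 0` on `Γ`. -/
def IsWeakSolution (f : ℝ → ℝ) (ω : Set (EuclideanSpace ℝ (Fin d))) (u : Space d → ℝ) : Prop :=
  ∃ g, InH10 ω u g ∧ ∀ v h, InH10 ω v h →
    IntegrableOn (fun x => f (u x) * v x) (cylinder ω) ∧
    (∫ x in cylinder ω, dot (g x) (h x)) - ∫ x in cylinder ω, f (u x) * v x = 0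

/-- The nodal domains of `u`: the connected components of `Ω_ω` minus the nodal set of `u`. -/
def nodalDomains (ω : Set (EuclideanSpace ℝ (Fin d))) (u : Space d → ℝ) : Set (Set (Space d)) :=
  {C | ∃ x ∈ cylinder ω \ {y | u y = 0},
    C = connectedComponentIn (cylinder ω \ {y | u y = 0}) x}

/-- `φ ∈ H_{0,x_N}^1(Ω_ω ∪ Γ)` (possibly `φ = 0`) solves weakly, in the space
`H_{0,x_N}^1(Ω_ω ∪ Γ)`, the equation `L_u φ = α φ`, where `L_u = -Δ - f'(u)`. -/
def IsOneDimEigen (f : ℝ → ℝ) (ω : Set (EuclideanSpace ℝ (Fin d))) (u : Space d → ℝ) (α : ℝ)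
    (φ : Space d → ℝ) : Prop :=
  IsOneDim ω φ ∧ ∃ g, InH10 ω φ g ∧ ∀ v h, InH10 ω v h → IsOneDim ω v →
    IntegrableOn (fun x => deriv f (u x) * φ x * v x) (cylinder ω) ∧
    (∫ x in cylinder ω, dot (g x) (h x)) - ∫ x in cylinder ω, deriv f (u x) * φ x * v x =
      α * ∫ x in cylinder ω, φ x * v x

/-! ### Linearity of these notions -/

lemma IsTest.memLp {U : Set (Space d)} {φ : Space d → ℝ} (h : IsTest U φ)
    (μ : Measure (Space d)) [IsFiniteMeasureOnCompacts μ] : MemLp φ 2 μ :=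
  h.smooth.continuous.memLp_of_hasCompactSupport h.compact

lemma IsTest.memLp_fderiv {U : Set (Space d)} {φ : Space d → ℝ} (h : IsTest U φ) (e : Space d)
    (μ : Measure (Space d)) [IsFiniteMeasureOnCompacts μ] :
    MemLp (fun x => fderiv ℝ φ x e) 2 μ := by
  apply Continuous.memLp_of_hasCompactSupport
  · exact (h.smooth.continuous_fderiv (by simp)).clm_apply continuous_const
  · exact h.compact.fderiv_apply ℝ e

lemma memLp_inner {μ : Measure (Space d)} {g : Space d → Space d} (hg : MemLp g 2 μ)
    (e : Space d) : MemLp (fun x => dot (g x) e) 2 μ := by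
  have h1 : MemLp (fun x => inner ℝ (g x).1 e.1) 2 μ := hg.fst.inner_const e.1
  exact h1.add (hg.snd.mul_const e.2)

lemma integrable_mul_of {μ : Measure (Space d)} {a b : Space d → ℝ} (ha : MemLp a 2 μ)
    (hb : MemLp b 2 μ) : Integrable (fun x => a x * b x) μ :=
  ha.integrable_mul hb

lemma integrable_dot {μ : Measure (Space d)} {g h : Space d → Space d} (hg : MemLp g 2 μ)
    (hh : MemLp h 2 μ) : Integrable (fun x => dot (g x) (h x)) μ := by
  have h1 : Integrable (fun x => inner ℝ (g x).1 (h x).1) μ :=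
    (L2.integrable_inner (𝕜 := ℝ) hg.fst.toLp hh.fst.toLp).congr (by
      filter_upwards [hg.fst.coeFn_toLp, hh.fst.coeFn_toLp] with x h1 h2
      rw [h1, h2])
  exact h1.add (hg.snd.integrable_mul hh.snd)

lemma dot_add (a b e : Space d) : dot (a + b) e = dot a e + dot b e := by
  simp only [dot, Prod.fst_add, Prod.snd_add, inner_add_left]; ring

lemma dot_smul (c : ℝ) (a e : Space d) : dot (c • a) e = c * dot a e := by
  simp only [dot, Prod.smul_fst, Prod.smul_snd, real_inner_smul_left, smul_eq_mul]; ring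

lemma InH10.congr {ω : Set (EuclideanSpace ℝ (Fin d))} {v w : Space d → ℝ} {g : Space d → Space d}
    (h : InH10 ω v g) (hvw : v =ᵐ[volume.restrict (cylinder ω)] w) : InH10 ω w g := by
  have key : ∀ p : Space d → ℝ,
      ∫ x in cylinder ω, w x * p x = ∫ x in cylinder ω, v x * p x := fun p =>
    integral_congr_ae (by filter_upwards [hvw] with x hx; rw [hx])
  refine ⟨h.memLp.ae_eq hvw, h.memLp_grad, fun φ hφ e => ?_, h.trace.1, fun φ hφ => ?_⟩
  · rw [key]; exact h.weakGradient φ hφ e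
  · rw [key]; exact h.trace.2 φ hφ

lemma InH10.zero (ω : Set (EuclideanSpace ℝ (Fin d))) : InH10 ω 0 0 := by
  refine ⟨MemLp.zero, MemLp.zero, fun φ _ e => ?_, MemLp.zero, fun φ _ => ?_⟩ <;> simp [dot]

lemma InH10.add {ω : Set (EuclideanSpace ℝ (Fin d))} {v w : Space d → ℝ} {g h : Space d → Space d}
    (hv : InH10 ω v g) (hw : InH10 ω w h) : InH10 ω (v + w) (g + h) := by
  refine ⟨hv.memLp.add hw.memLp, hv.memLp_grad.add hw.memLp_grad, fun φ hφ e => ?_, MemLp.zero,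
    fun φ hφ => ?_⟩
  · have h1 := hv.weakGradient φ hφ e
    have h2 := hw.weakGradient φ hφ e
    simp only [Pi.add_apply, dot_add, add_mul]
    rw [integral_add (integrable_mul_of hv.memLp (hφ.memLp_fderiv e _))
      (integrable_mul_of hw.memLp (hφ.memLp_fderiv e _)),
      integral_add (integrable_mul_of (memLp_inner hv.memLp_grad e) (hφ.memLp _))
      (integrable_mul_of (memLp_inner hw.memLp_grad e) (hφ.memLp _)), h1, h2]
    ring
  · have h1 := hv.trace.2 φ hφ
    have h2 := hw.trace.2 φ hφ
    simp only [Pi.zero_apply, zero_mul, integral_zero] at h1 h2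
    simp only [Pi.add_apply, Prod.snd_add, add_mul, Pi.zero_apply, zero_mul, integral_zero]
    rw [integral_add (integrable_mul_of hv.memLp (hφ.memLp_fderiv _ _))
      (integrable_mul_of hw.memLp (hφ.memLp_fderiv _ _)),
      integral_add (integrable_mul_of hv.memLp_grad.snd (hφ.memLp _))
      (integrable_mul_of hw.memLp_grad.snd (hφ.memLp _)), h1, h2]
    ring

lemma InH10.smul {ω : Set (EuclideanSpace ℝ (Fin d))} {v : Space d → ℝ} {g : Space d → Space d}
    (c : ℝ) (hv : InH10 ω v g) : InH10 ω (c • v) (c • g) := by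
  refine ⟨hv.memLp.const_smul c, hv.memLp_grad.const_smul c, fun φ hφ e => ?_, MemLp.zero,
    fun φ hφ => ?_⟩
  · have h1 := hv.weakGradient φ hφ e
    simp only [Pi.smul_apply, dot_smul, smul_eq_mul, mul_assoc, integral_const_mul, h1]
    ring
  · have h1 := hv.trace.2 φ hφ
    simp only [Pi.zero_apply, zero_mul, integral_zero] at h1
    simp only [Pi.smul_apply, Prod.smul_snd, smul_eq_mul, mul_assoc, integral_const_mul, h1,
      Pi.zero_apply, zero_mul, integral_zero]
    ring

lemma IsOneDim.congr {ω : Set (EuclideanSpace ℝ (Fin d))} {v w : Space d → ℝ}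
    (h : IsOneDim ω v) (hvw : v =ᵐ[volume.restrict (cylinder ω)] w) : IsOneDim ω w := by
  obtain ⟨V, hV⟩ := h
  exact ⟨V, by filter_upwards [hV, hvw] with x h1 h2; rw [← h2, h1]⟩

lemma IsOneDimEigen.congr {f : ℝ → ℝ} {ω : Set (EuclideanSpace ℝ (Fin d))} {u : Space d → ℝ}
    {α : ℝ} {φ ψ : Space d → ℝ} (hφ : IsOneDimEigen f ω u α φ)
    (h : φ =ᵐ[volume.restrict (cylinder ω)] ψ) : IsOneDimEigen f ω u α ψ := by
  obtain ⟨h1, g, hg, hE⟩ := hφ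
  refine ⟨h1.congr h, g, hg.congr h, fun v k hv hv1 => ?_⟩
  obtain ⟨hi, he⟩ := hE v k hv hv1
  have e1 : (fun x => deriv f (u x) * φ x * v x) =ᵐ[volume.restrict (cylinder ω)]
      fun x => deriv f (u x) * ψ x * v x := by
    filter_upwards [h] with x hx; rw [hx]
  have e2 : (fun x => φ x * v x) =ᵐ[volume.restrict (cylinder ω)] fun x => ψ x * v x := by
    filter_upwards [h] with x hx; rw [hx]
  refine ⟨hi.congr e1, ?_⟩
  rw [← integral_congr_ae e1, ← integral_congr_ae e2]
  exact he

lemma IsOneDimEigen.zero (f : ℝ → ℝ) (ω : Set (EuclideanSpace ℝ (Fin d))) (u : Space d → ℝ)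
    (α : ℝ) : IsOneDimEigen f ω u α 0 :=
  ⟨⟨0, by simp⟩, 0, InH10.zero ω, fun v h _ _ => by simp [dot]⟩

lemma IsOneDimEigen.add {f : ℝ → ℝ} {ω : Set (EuclideanSpace ℝ (Fin d))} {u : Space d → ℝ}
    {α : ℝ} {φ ψ : Space d → ℝ} (hφ : IsOneDimEigen f ω u α φ) (hψ : IsOneDimEigen f ω u α ψ) :
    IsOneDimEigen f ω u α (φ + ψ) := by
  obtain ⟨⟨V, hV⟩, g, hg, hE⟩ := hφ
  obtain ⟨⟨W, hW⟩, g', hg', hE'⟩ := hψ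
  refine ⟨⟨V + W, ?_⟩, g + g', hg.add hg', fun v h hv hv1 => ?_⟩
  · filter_upwards [hV, hW] with x h1 h2
    simp [h1, h2]
  · obtain ⟨i1, e1⟩ := hE v h hv hv1
    obtain ⟨i2, e2⟩ := hE' v h hv hv1
    simp only [Pi.add_apply, dot_add, mul_add, add_mul]
    refine ⟨i1.add i2, ?_⟩
    rw [integral_add (integrable_dot hg.memLp_grad hv.memLp_grad)
      (integrable_dot hg'.memLp_grad hv.memLp_grad), integral_add i1 i2,
      integral_add (integrable_mul_of hg.memLp hv.memLp) (integrable_mul_of hg'.memLp hv.memLp)]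
    linarith

lemma IsOneDimEigen.smul {f : ℝ → ℝ} {ω : Set (EuclideanSpace ℝ (Fin d))} {u : Space d → ℝ}
    {α : ℝ} {φ : Space d → ℝ} (c : ℝ) (hφ : IsOneDimEigen f ω u α φ) :
    IsOneDimEigen f ω u α (c • φ) := by
  obtain ⟨⟨V, hV⟩, g, hg, hE⟩ := hφ
  refine ⟨⟨c • V, ?_⟩, c • g, hg.smul c, fun v h hv hv1 => ?_⟩
  · filter_upwards [hV] with x h1
    simp [h1]
  · obtain ⟨i1, e1⟩ := hE v h hv hv1
    have r : ∀ x, deriv f (u x) * (c * φ x) * v x = c * (deriv f (u x) * φ x * v x) :=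
      fun x => by ring
    simp only [Pi.smul_apply, dot_smul, smul_eq_mul, r, mul_assoc c, integral_const_mul]
    refine ⟨i1.const_mul c, ?_⟩
    linear_combination c * e1

/-! ### The Morse index -/

/-- The eigenspace, in `L²(Ω_ω)`, of `L_u = -Δ - f'(u)` in `H_{0,x_N}^1(Ω_ω ∪ Γ)` for the real
number `α`; it is nonzero exactly if `α` is an eigenvalue. -/
def oneDimEigenspace (f : ℝ → ℝ) (ω : Set (EuclideanSpace ℝ (Fin d))) (u : Space d → ℝ) (α : ℝ) :
    Submodule ℝ (Lp ℝ 2 (volume.restrict (cylinder ω))) where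
  carrier := {φ | IsOneDimEigen f ω u α φ}
  zero_mem' := (IsOneDimEigen.zero f ω u α).congr (Lp.coeFn_zero _ _ _).symm
  add_mem' {φ ψ} hφ hψ := (IsOneDimEigen.add hφ hψ).congr (Lp.coeFn_add φ ψ).symm
  smul_mem' c φ hφ := (IsOneDimEigen.smul c hφ).congr (Lp.coeFn_smul c φ).symm

/-- The one-dimensional Morse index `m^{x_N}(u)`: the number of negative eigenvalues, counted with
multiplicity, of `L_u = -Δ - f'(u)` in the space `H_{0,x_N}^1(Ω_ω ∪ Γ)`. -/
def oneDimMorseIndex (f : ℝ → ℝ) (ω : Set (EuclideanSpace ℝ (Fin d))) (u : Space d → ℝ) : ℕ∞ :=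
  ∑' α : Iio (0 : ℝ), Cardinal.toENat (Module.rank ℝ (oneDimEigenspace f ω u α))

/-- `α` is an eigenvalue of the problem `-z'' - f'(U) z = α z` in `(0, 1)`, `z'(0) = z(1) = 0`, with
a (classical) eigenfunction `z ∈ C²([0, 1])`. -/
def IsODEEigenvalue (f U : ℝ → ℝ) (α : ℝ) : Prop :=
  ∃ z : ℝ → ℝ, ContDiffOn ℝ 2 z (Icc 0 1) ∧
    (∀ s ∈ Ioo (0 : ℝ) 1, - deriv (deriv z) s - deriv f (U s) * z s = α * z s) ∧
    derivWithin z (Icc 0 1) 0 = 0 ∧ z 1 = 0 ∧ ∃ s ∈ Ioo (0 : ℝ) 1, z s ≠ 0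

end OneDimMorse

end

/-!
The weak equations on the cylinder reduce to ordinary differential equations on `(0, 1)`, and the
negative eigenvalues are then counted by Prüfer angles.

*Reduction.* The functions of `H_0^1(Ω_ω ∪ Γ)` which depend only on `x_N` are the functions
`x ↦ w(x_N)` with `w ∈ H¹(0, 1)`, `w(1) = 0` (`IsSmoothBoundedDomain.inH10_prim` and
`IsSmoothBoundedDomain.exists_prim`). Here `w` is encoded by its derivative `G ∈ L²(0, 1)`, as
`w = prim G`. Testing with such functions shows that `u` is given by a classical solution of
`-U'' = f(U)`, `U'(0) = U(1) = 0`, and that the one-dimensional weak eigenfunctions for `a` are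
the classical solutions of `-z'' - f'(U) z = a z`, `z'(0) = z(1) = 0`. By uniqueness for the initial
value problem each eigenspace has dimension at most one, so the Morse index is the number of
negative eigenvalues of the ODE problem.

*Angles.* Write a solution of `z'' = - p z` as `z = R sin θ`, `z' = R cos θ`. Then
`θ' = 1 + (p - 1) sin² θ`, and the difference of two angles solves a scalar linear equation. This
yields all the comparison statements: angles are monotone in `p` and in the initial value, and cross
the multiples of `π` upwards only. Let `θ_a` be the angle for `p = f'(U) + a` with
`θ_a(0) = π / 2`. The number `a` is an eigenvalue exactly if `θ_a(1)` is a multiple of `π`. The map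
`a ↦ θ_a(1)` is continuous, strictly increasing and positive, and it is below `π` for very negative
`a`, so the number of negative eigenvalues is `n` as soon as `n π < θ_0(1) < (n + 1) π`
(`encard_angle_one`).

*Squeezing `θ_0(1)`* (`angle_linearized_bounds`). Let `φ` be the angle of `U`, normalized by
`φ(0) = π / 2`; the function `U` solves the linear equation with `p = f(U) / U`. The nodal domains
of `u` are the slabs between successive multiples of `π` of `φ`, so `φ(1) = n π`
(`IsSmoothBoundedDomain.encard_nodalDomains`). Since `f(U) / U < f'(U)` where `U ≠ 0`, comparison
gives `n π < θ_0(1)`. The derivative `U'` solves the linearized equation; its angle `ψ`, normalized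
by `ψ(0) = π`, therefore stays above `θ_0`. Finally `sin (ψ - φ)` is a positive multiple of
`U' ^ 2 + U f(U) > 0`, so `ψ - φ` stays below `π`, and `θ_0(1) < ψ(1) < (n + 1) π`.
-/

noncomputable section

namespace OneDimMorse

variable {d : ℕ}

/-! ### Scalar linear differential inequalities -/

/-- A solution of `R' = c R`, `R a = 1`, on a compact interval; it is positive. -/
theorem exists_integrating_factor {a b : ℝ} (hab : a ≤ b) {c : ℝ → ℝ}
    (hc : ContinuousOn c (Icc a b)) :
    ∃ R : ℝ → ℝ, (∀ t, 0 < R t) ∧ R a = 1 ∧ ∀ t ∈ Icc a b, HasDerivAt R (c t * R t) t := by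
  obtain ⟨c', hc', hcc⟩ : ∃ c' : ℝ → ℝ, Continuous c' ∧ ∀ t ∈ Icc a b, c' t = c t :=
    ⟨_, (continuousOn_iff_continuous_domRestrict.1 hc).Icc_extend' (h := hab), fun t ht => by
      rw [IccExtend_of_mem hab _ ht]; rfl⟩
  refine ⟨fun t => Real.exp (∫ s in a..t, c' s), fun t => Real.exp_pos _, by simp,
    fun t ht => ?_⟩
  have h := ((hc'.integral_hasStrictDerivAt a t).hasDerivAt).exp
  rw [hcc t ht] at h
  simpa [mul_comm] using h

theorem hasDerivAt_div_integrating_factor {D c g R : ℝ → ℝ} {t : ℝ}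
    (hD : HasDerivAt D (c t * D t + g t) t) (hR : 0 < R t) (hR' : HasDerivAt R (c t * R t) t) :
    HasDerivAt (fun s => D s / R s) (g t / R t) t := by
  convert! hD.div hR' hR.ne' using 1
  field_simp
  ring

theorem monotoneOn_div_integrating_factor {a b : ℝ} {D c g R : ℝ → ℝ}
    (hD : ContinuousOn D (Icc a b)) (hD' : ∀ t ∈ Ioo a b, HasDerivAt D (c t * D t + g t) t)
    (hg : ∀ t ∈ Ioo a b, 0 ≤ g t) (hR : ∀ t, 0 < R t)
    (hR' : ∀ t ∈ Icc a b, HasDerivAt R (c t * R t) t) :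
    MonotoneOn (fun t => D t / R t) (Icc a b) := by
  apply monotoneOn_of_hasDerivWithinAt_nonneg (convex_Icc a b)
    (f' := fun t => g t / R t)
  · exact hD.div (fun s hs => (hR' s hs).continuousAt.continuousWithinAt) fun s _ => (hR s).ne'
  · intro t ht
    rw [interior_Icc] at ht
    exact (hasDerivAt_div_integrating_factor (hD' t ht) (hR t)
      (hR' t (Ioo_subset_Icc_self ht))).hasDerivWithinAt
  · intro t ht
    rw [interior_Icc] at ht
    exact div_nonneg (hg t ht) (hR t).le

/-- A solution of the homogeneous equation `D' = c D` is a multiple of the positive one. -/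
theorem linear_ode_eq {a b : ℝ} {D c R : ℝ → ℝ} (hD : ContinuousOn D (Icc a b))
    (hD' : ∀ t ∈ Ioo a b, HasDerivAt D (c t * D t) t) (hR : ∀ t, 0 < R t) (hRa : R a = 1)
    (hR' : ∀ t ∈ Icc a b, HasDerivAt R (c t * R t) t) {t : ℝ} (ht : t ∈ Icc a b) :
    D t = D a * R t := by
  have ha : a ∈ Icc a b := ⟨le_rfl, ht.1.trans ht.2⟩
  have h1 := monotoneOn_div_integrating_factor (g := 0) hD
    (fun t ht => by simpa using hD' t ht) (fun _ _ => le_rfl) hR hR' ha ht ht.1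
  have h2 := monotoneOn_div_integrating_factor (D := -D) (g := 0) hD.neg
    (fun t ht => by simpa using (hD' t ht).neg) (fun _ _ => le_rfl) hR hR' ha ht ht.1
  simp only [Pi.neg_apply, hRa, div_one, neg_div, neg_le_neg_iff] at h1 h2
  have h3 := le_antisymm h1 h2
  have := (hR t).ne'
  field_simp at h3
  linarith

theorem linear_ode_nonneg {a b : ℝ} {D c g : ℝ → ℝ} (hD : ContinuousOn D (Icc a b))
    (hc : ContinuousOn c (Icc a b)) (hD' : ∀ t ∈ Ioo a b, HasDerivAt D (c t * D t + g t) t)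
    (hg : ∀ t ∈ Ioo a b, 0 ≤ g t) (hDa : 0 ≤ D a) {t : ℝ} (ht : t ∈ Icc a b) : 0 ≤ D t := by
  have ha : a ∈ Icc a b := ⟨le_rfl, ht.1.trans ht.2⟩
  obtain ⟨R, hR, hRa, hR'⟩ := exists_integrating_factor (ht.1.trans ht.2) hc
  have h1 : D a / R a ≤ D t / R t := monotoneOn_div_integrating_factor hD hD' hg hR hR' ha ht ht.1
  rw [hRa, div_one, le_div_iff₀ (hR t)] at h1
  exact (mul_nonneg hDa (hR t).le).trans h1

theorem linear_ode_pos_of_pos {a b : ℝ} {D c g : ℝ → ℝ} (hD : ContinuousOn D (Icc a b))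
    (hc : ContinuousOn c (Icc a b)) (hD' : ∀ t ∈ Ioo a b, HasDerivAt D (c t * D t + g t) t)
    (hg : ∀ t ∈ Ioo a b, 0 ≤ g t) (hDa : 0 < D a) {t : ℝ} (ht : t ∈ Icc a b) : 0 < D t := by
  have ha : a ∈ Icc a b := ⟨le_rfl, ht.1.trans ht.2⟩
  obtain ⟨R, hR, hRa, hR'⟩ := exists_integrating_factor (ht.1.trans ht.2) hc
  have h1 : D a / R a ≤ D t / R t := monotoneOn_div_integrating_factor hD hD' hg hR hR' ha ht ht.1
  rw [hRa, div_one, le_div_iff₀ (hR t)] at h1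
  exact (mul_pos hDa (hR t)).trans_le h1

/-- If the nonnegative forcing term is positive somewhere, then a solution which starts from a
nonnegative value ends at a positive one. -/
theorem linear_ode_pos {a b : ℝ} {D c g : ℝ → ℝ} (hD : ContinuousOn D (Icc a b))
    (hc : ContinuousOn c (Icc a b)) (hD' : ∀ t ∈ Ioo a b, HasDerivAt D (c t * D t + g t) t)
    (hg : ∀ t ∈ Ioo a b, 0 ≤ g t) (hDa : 0 ≤ D a) {t₀ : ℝ} (ht₀ : t₀ ∈ Ioo a b)
    (hgt : 0 < g t₀) : 0 < D b := by
  have hab : a ≤ b := (ht₀.1.trans ht₀.2).le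
  have ha : a ∈ Icc a b := left_mem_Icc.2 hab
  have hb : b ∈ Icc a b := right_mem_Icc.2 hab
  obtain ⟨R, hR, hRa, hR'⟩ := exists_integrating_factor hab hc
  have hm := monotoneOn_div_integrating_factor hD hD' hg hR hR'
  by_contra hneg
  have hb0 : D b / R b ≤ 0 := div_nonpos_of_nonpos_of_nonneg (not_lt.1 hneg) (hR b).le
  -- otherwise `D / R`, which is monotone, vanishes identically
  have hz : ∀ t ∈ Icc a b, D t / R t = 0 := fun t ht => by
    have h1 : D t / R t ≤ D b / R b := hm ht hb ht.2
    have h2 : D a / R a ≤ D t / R t := hm ha ht ht.1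
    have h3 : 0 ≤ D a / R a := div_nonneg hDa (hR a).le
    linarith
  have h1 := hasDerivAt_div_integrating_factor (hD' t₀ ht₀) (hR t₀)
    (hR' t₀ (Ioo_subset_Icc_self ht₀))
  have h2 : HasDerivAt (fun s => D s / R s) 0 t₀ := by
    apply (hasDerivAt_const t₀ (0 : ℝ)).congr_of_eventuallyEq
    filter_upwards [Icc_mem_nhds ht₀.1 ht₀.2] with t ht using hz t ht
  exact (div_pos hgt (hR t₀)).ne' (h1.unique h2)

/-! ### The Prüfer angle -/

/-- `θ` is a Prüfer angle on `[0, 1]` for the equation `z'' = - p z`: the equation satisfied by `θ`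
when `z = R sin θ` and `z' = R cos θ`. The derivatives at the endpoints are two-sided, so that `θ`
is understood to be defined slightly beyond `[0, 1]`. -/
def IsAngle (p θ : ℝ → ℝ) : Prop :=
  ∀ t ∈ Icc (0 : ℝ) 1, HasDerivAt θ (1 + (p t - 1) * Real.sin (θ t) ^ 2) t

theorem IsAngle.continuousOn {p θ : ℝ → ℝ} (h : IsAngle p θ) : ContinuousOn θ (Icc 0 1) :=
  fun t ht => (h t ht).continuousAt.continuousWithinAt

theorem sin_eq_sinc_mul (x : ℝ) : Real.sin x = Real.sinc x * x := by
  by_cases hx : x = 0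
  · simp [hx]
  · rw [Real.sinc_of_ne_zero hx]; field_simp

/-- The factor `x - y` is split off by means of the continuous function `sinc`, so that the
difference of two Prüfer angles solves a linear equation with continuous coefficient. -/
theorem sin_sq_sub_sin_sq (x y : ℝ) :
    Real.sin x ^ 2 - Real.sin y ^ 2 = Real.sin (x + y) * Real.sinc (x - y) * (x - y) := by
  rw [mul_assoc, ← sin_eq_sinc_mul, Real.sin_add, Real.sin_sub]
  nlinarith [Real.sin_sq_add_cos_sq x, Real.sin_sq_add_cos_sq y]

theorem abs_sin_sq_sub_sin_sq_le (x y : ℝ) :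
    |Real.sin x ^ 2 - Real.sin y ^ 2| ≤ |x - y| := by
  rw [sin_sq_sub_sin_sq, abs_mul, abs_mul]
  have h1 := mul_le_one₀ (Real.abs_sin_le_one (x + y)) (abs_nonneg _)
    (Real.abs_sinc_le_one (x - y))
  exact mul_le_of_le_one_left (abs_nonneg _) h1

/-- The angle equation has a bounded right-hand side, so its solutions exist on all of `[0, 1]`; the
Picard-Lindelöf theorem is applied on `[-1, 2]` to obtain two-sided derivatives at `0` and `1`. -/
theorem exists_isAngle {p : ℝ → ℝ} (hp : Continuous p) (θ₀ : ℝ) :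
    ∃ θ : ℝ → ℝ, θ 0 = θ₀ ∧ IsAngle p θ := by
  obtain ⟨M, hM⟩ := isCompact_Icc.exists_bound_of_continuousOn (s := Icc (-1 : ℝ) 2)
    (f := fun t => p t - 1) (by fun_prop)
  have hM0 : 0 ≤ M := (norm_nonneg _).trans (hM 0 (by norm_num))
  have h0 : (0 : ℝ) ∈ Icc (-1 : ℝ) 2 := by norm_num
  lift M to NNReal using hM0
  have hPL : IsPicardLindelof (fun t x => 1 + (p t - 1) * Real.sin x ^ 2) (⟨0, h0⟩ : Icc (-1 : ℝ) 2)
      θ₀ ((1 + M) * 2) 0 (1 + M) M := by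
    refine ⟨fun t ht => ?_, fun x _ => by fun_prop, fun t ht x _ => ?_, ?_⟩
    · refine (LipschitzWith.of_dist_le_mul fun x y => ?_).lipschitzOnWith
      rw [Real.dist_eq, Real.dist_eq, add_sub_add_left_eq_sub, ← mul_sub, abs_mul]
      exact mul_le_mul (hM t ht) (abs_sin_sq_sub_sin_sq_le x y) (abs_nonneg _) M.2
    · have h1 : ‖(p t - 1) * Real.sin x ^ 2‖ ≤ M := by
        rw [norm_mul]
        refine (mul_le_of_le_one_right (norm_nonneg _) ?_).trans (hM t ht)
        rw [norm_pow, Real.norm_eq_abs]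
        exact pow_le_one₀ (abs_nonneg _) (Real.abs_sin_le_one x)
      refine (norm_add_le _ _).trans ?_
      push_cast
      simpa using h1
    · simp
  obtain ⟨θ, h1, h2⟩ := hPL.exists_eq_forall_mem_Icc_hasDerivWithinAt₀
  exact ⟨θ, h1, fun t ht => (h2 t ⟨by linarith [ht.1], by linarith [ht.2]⟩).hasDerivAt
    (Icc_mem_nhds (by linarith [ht.1]) (by linarith [ht.2]))⟩

/-- The difference of two Prüfer angles solves a linear differential equation. -/
theorem IsAngle.hasDerivAt_sub {p₁ p₂ θ₁ θ₂ : ℝ → ℝ} (h₁ : IsAngle p₁ θ₁) (h₂ : IsAngle p₂ θ₂)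
    {t : ℝ} (ht : t ∈ Icc (0 : ℝ) 1) :
    HasDerivAt (fun t => θ₂ t - θ₁ t)
      ((p₂ t - 1) * (Real.sin (θ₂ t + θ₁ t) * Real.sinc (θ₂ t - θ₁ t)) * (θ₂ t - θ₁ t)
        + (p₂ t - p₁ t) * Real.sin (θ₁ t) ^ 2) t := by
  convert! (h₂ t ht).sub (h₁ t ht) using 1
  linear_combination -(p₂ t - 1) * sin_sq_sub_sin_sq (θ₂ t) (θ₁ t)

theorem IsAngle.continuousOn_coeff {p₁ p₂ θ₁ θ₂ : ℝ → ℝ} (h₁ : IsAngle p₁ θ₁)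
    (h₂ : IsAngle p₂ θ₂) (hp₂ : Continuous p₂) :
    ContinuousOn (fun t => (p₂ t - 1) * (Real.sin (θ₂ t + θ₁ t) * Real.sinc (θ₂ t - θ₁ t)))
      (Icc 0 1) := by
  have := h₁.continuousOn
  have := h₂.continuousOn
  have hs := Real.continuous_sinc
  refine ContinuousOn.mul (by fun_prop) (ContinuousOn.mul ?_ ?_)
  · exact Real.continuous_sin.comp_continuousOn (by fun_prop)
  · exact hs.comp_continuousOn (by fun_prop)

theorem IsAngle.le {p₁ p₂ θ₁ θ₂ : ℝ → ℝ} (h₁ : IsAngle p₁ θ₁) (h₂ : IsAngle p₂ θ₂)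
    (hp₂ : Continuous p₂) (hp : ∀ t ∈ Ioo (0 : ℝ) 1, p₁ t ≤ p₂ t) (h0 : θ₁ 0 ≤ θ₂ 0) :
    ∀ t ∈ Icc (0 : ℝ) 1, θ₁ t ≤ θ₂ t := fun t ht => by
  have := linear_ode_nonneg (D := fun t => θ₂ t - θ₁ t) (h₂.continuousOn.sub h₁.continuousOn)
    (h₁.continuousOn_coeff h₂ hp₂)
    (fun t ht => h₁.hasDerivAt_sub h₂ (Ioo_subset_Icc_self ht))
    (fun t ht => mul_nonneg (sub_nonneg.2 (hp t ht)) (sq_nonneg _)) (sub_nonneg.2 h0) ht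
  linarith

theorem IsAngle.lt_of_lt {p₁ p₂ θ₁ θ₂ : ℝ → ℝ} (h₁ : IsAngle p₁ θ₁) (h₂ : IsAngle p₂ θ₂)
    (hp₂ : Continuous p₂) (hp : ∀ t ∈ Ioo (0 : ℝ) 1, p₁ t ≤ p₂ t) (h0 : θ₁ 0 < θ₂ 0) :
    ∀ t ∈ Icc (0 : ℝ) 1, θ₁ t < θ₂ t := fun t ht => by
  have := linear_ode_pos_of_pos (D := fun t => θ₂ t - θ₁ t) (h₂.continuousOn.sub h₁.continuousOn)
    (h₁.continuousOn_coeff h₂ hp₂)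
    (fun t ht => h₁.hasDerivAt_sub h₂ (Ioo_subset_Icc_self ht))
    (fun t ht => mul_nonneg (sub_nonneg.2 (hp t ht)) (sq_nonneg _)) (sub_pos.2 h0) ht
  linarith

/-- Sturm comparison: the inequality is strict at `1` if the potentials differ at a point where the
solution of angle `θ₁` does not vanish. -/
theorem IsAngle.lt {p₁ p₂ θ₁ θ₂ : ℝ → ℝ} (h₁ : IsAngle p₁ θ₁) (h₂ : IsAngle p₂ θ₂)
    (hp₂ : Continuous p₂) (hp : ∀ t ∈ Ioo (0 : ℝ) 1, p₁ t ≤ p₂ t) (h0 : θ₁ 0 ≤ θ₂ 0) {t₀ : ℝ}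
    (ht₀ : t₀ ∈ Ioo (0 : ℝ) 1) (hlt : p₁ t₀ < p₂ t₀) (hsin : Real.sin (θ₁ t₀) ≠ 0) :
    θ₁ 1 < θ₂ 1 := by
  have := linear_ode_pos (D := fun t => θ₂ t - θ₁ t) (h₂.continuousOn.sub h₁.continuousOn)
    (h₁.continuousOn_coeff h₂ hp₂)
    (fun t ht => h₁.hasDerivAt_sub h₂ (Ioo_subset_Icc_self ht))
    (fun t ht => mul_nonneg (sub_nonneg.2 (hp t ht)) (sq_nonneg _)) (sub_nonneg.2 h0) ht₀
    (mul_pos (sub_pos.2 hlt) (by positivity))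
  linarith

/-- A Prüfer angle crosses the multiples of `π` upwards only. -/
theorem IsAngle.lt_of_int_mul_pi_le {p θ : ℝ → ℝ} (h : IsAngle p θ) (hp : Continuous p) (k : ℤ)
    {s t : ℝ} (hs : 0 ≤ s) (hst : s < t) (ht : t ≤ 1) (hk : k * Real.pi ≤ θ s) :
    k * Real.pi < θ t := by
  have hsub : Icc s t ⊆ Icc (0 : ℝ) 1 := Icc_subset_Icc hs ht
  have hθ : ContinuousOn (fun t => θ t - k * Real.pi) (Icc s t) :=
    (h.continuousOn.mono hsub).sub continuousOn_const
  have := linear_ode_pos (D := fun t => θ t - k * Real.pi) (g := fun _ => 1)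
    (c := fun t => (p t - 1) * (Real.sin (θ t - k * Real.pi) * Real.sinc (θ t - k * Real.pi)))
    (a := s) (b := t) hθ
    (ContinuousOn.mul (by fun_prop) ((Real.continuous_sin.comp_continuousOn hθ).mul
      (Real.continuous_sinc.comp_continuousOn hθ)))
    (fun r hr => ?_) (fun _ _ => zero_le_one) (sub_nonneg.2 hk) (t₀ := (s + t) / 2)
    ⟨by linarith, by linarith⟩ one_pos
  · simpa using this
  · convert! (h r (hsub (Ioo_subset_Icc_self hr))).sub_const (k * Real.pi) using 1
    have h1 : Real.sin (θ r) ^ 2 = Real.sin (θ r - k * Real.pi) ^ 2 := by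
      rw [Real.sin_sub_int_mul_pi, mul_pow, ← sq_abs ((-1 : ℝ) ^ k), abs_zpow]
      simp
    rw [h1, pow_two, mul_assoc, mul_assoc, ← sin_eq_sinc_mul]
    ring

/-! ### Polar coordinates in the phase plane -/

/-- `z` and `y = z'` solve the equation `z'' = - p z` in `(0, 1)` and are continuous on `[0, 1]`. -/
structure IsSol (p z y : ℝ → ℝ) : Prop where
  cont_left : ContinuousOn z (Icc 0 1)
  cont_right : ContinuousOn y (Icc 0 1)
  deriv_left : ∀ t ∈ Ioo (0 : ℝ) 1, HasDerivAt z (y t) t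
  deriv_right : ∀ t ∈ Ioo (0 : ℝ) 1, HasDerivAt y (-(p t * z t)) t

/-- `R` is the radial coordinate, normalized by `R 0 = 1`, of the solutions with angle `θ`. -/
structure IsRadius (p θ R : ℝ → ℝ) : Prop where
  pos : ∀ t, 0 < R t
  zero : R 0 = 1
  deriv : ∀ t ∈ Icc (0 : ℝ) 1,
    HasDerivAt R ((1 - p t) * (Real.sin (θ t) * Real.cos (θ t)) * R t) t

theorem IsAngle.exists_isRadius {p θ : ℝ → ℝ} (h : IsAngle p θ) (hp : Continuous p) :
    ∃ R, IsRadius p θ R := by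
  have hθ := h.continuousOn
  obtain ⟨R, h1, h2, h3⟩ := exists_integrating_factor zero_le_one
    (c := fun t => (1 - p t) * (Real.sin (θ t) * Real.cos (θ t)))
    (ContinuousOn.mul (by fun_prop) ((Real.continuous_sin.comp_continuousOn hθ).mul
      (Real.continuous_cos.comp_continuousOn hθ)))
  exact ⟨R, h1, h2, h3⟩

theorem IsRadius.hasDerivAt_sin {p θ R : ℝ → ℝ} (h : IsAngle p θ) (hR : IsRadius p θ R) {t : ℝ}
    (ht : t ∈ Icc (0 : ℝ) 1) :
    HasDerivAt (fun t => R t * Real.sin (θ t)) (R t * Real.cos (θ t)) t := by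
  convert! (hR.deriv t ht).mul (h t ht).sin using 1
  ring

theorem IsRadius.hasDerivAt_cos {p θ R : ℝ → ℝ} (h : IsAngle p θ) (hR : IsRadius p θ R) {t : ℝ}
    (ht : t ∈ Icc (0 : ℝ) 1) :
    HasDerivAt (fun t => R t * Real.cos (θ t)) (-(p t * (R t * Real.sin (θ t)))) t := by
  convert! (hR.deriv t ht).mul (h t ht).cos using 1
  linear_combination ((p t - 1) * R t * Real.sin (θ t)) * Real.sin_sq_add_cos_sq (θ t)

/-- A solution whose initial data have angle `θ 0` has angle `θ` throughout. In particular this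
gives uniqueness for the initial value problem. -/
theorem IsSol.polar {p θ R z y : ℝ → ℝ} (hp : Continuous p) (hz : IsSol p z y) (h : IsAngle p θ)
    (hR : IsRadius p θ R) (h0 : z 0 * Real.cos (θ 0) = y 0 * Real.sin (θ 0)) {t : ℝ}
    (ht : t ∈ Icc (0 : ℝ) 1) :
    z t = (z 0 * Real.sin (θ 0) + y 0 * Real.cos (θ 0)) * (R t * Real.sin (θ t)) ∧
      y t = (z 0 * Real.sin (θ 0) + y 0 * Real.cos (θ 0)) * (R t * Real.cos (θ t)) := by
  have hsc : ∀ t, Real.sin (θ t) ^ 2 + Real.cos (θ t) ^ 2 = 1 := fun t =>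
    Real.sin_sq_add_cos_sq _
  have hs : ContinuousOn (fun t => Real.sin (θ t)) (Icc 0 1) :=
    Real.continuous_sin.comp_continuousOn h.continuousOn
  have hc : ContinuousOn (fun t => Real.cos (θ t)) (Icc 0 1) :=
    Real.continuous_cos.comp_continuousOn h.continuousOn
  have hzc := hz.cont_left
  have hyc := hz.cont_right
  -- the component orthogonal to the direction of angle `θ` vanishes
  have hA : ∀ t ∈ Icc (0 : ℝ) 1, z t * Real.cos (θ t) = y t * Real.sin (θ t) := by
    obtain ⟨Q, hQ1, hQ2, hQ3⟩ := exists_integrating_factor zero_le_one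
      (c := fun t => (p t - 1) * (Real.sin (θ t) * Real.cos (θ t)))
      (ContinuousOn.mul (by fun_prop) (hs.mul hc))
    intro t ht
    have := linear_ode_eq (D := fun t => z t * Real.cos (θ t) - y t * Real.sin (θ t))
      ((hzc.mul hc).sub (hyc.mul hs)) (fun r hr => ?_) hQ1 hQ2 hQ3 ht
    · rw [h0, sub_self, zero_mul] at this
      linarith
    · have hr' := Ioo_subset_Icc_self hr
      convert! ((hz.deriv_left r hr).mul (h r hr').cos).sub
        ((hz.deriv_right r hr).mul (h r hr').sin) using 1
      linear_combination ((p r - 1) * z r * Real.sin (θ r)) * hsc r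
  have hB := linear_ode_eq (D := fun t => z t * Real.sin (θ t) + y t * Real.cos (θ t))
    ((hzc.mul hs).add (hyc.mul hc)) (fun r hr => ?_) hR.pos hR.zero hR.deriv ht
  · have hAt := hA t ht
    constructor
    · linear_combination Real.cos (θ t) * hAt + Real.sin (θ t) * hB - z t * hsc t
    · linear_combination -Real.sin (θ t) * hAt + Real.cos (θ t) * hB - y t * hsc t
  · have hr' := Ioo_subset_Icc_self hr
    convert! ((hz.deriv_left r hr).mul (h r hr').sin).add
      ((hz.deriv_right r hr).mul (h r hr').cos) using 1
    have hAr := hA r hr'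
    linear_combination ((1 - p r) * (Real.sin (θ r) ^ 2 - Real.cos (θ r) ^ 2)) * hAr +
      ((1 - p r) * z r * Real.cos (θ r)) * hsc r

/-! ### Counting negative eigenvalues by the angle -/

section Counting

variable {q : ℝ → ℝ} {θ : ℝ → ℝ → ℝ}

theorem IsAngle.pos_one {p θ : ℝ → ℝ} (h : IsAngle p θ) (hp : Continuous p)
    (h0 : θ 0 = Real.pi / 2) : 0 < θ 1 := by
  have := h.lt_of_int_mul_pi_le hp 0 le_rfl zero_lt_one le_rfl
    (by rw [h0]; simpa using (half_pos Real.pi_pos).le)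
  simpa using this

theorem strictMono_angle_one (hq : Continuous q) (hθ : ∀ a, IsAngle (fun t => q t + a) (θ a))
    (h0 : ∀ a, θ a 0 = Real.pi / 2) : StrictMono fun a => θ a 1 := by
  intro a b hab
  -- near `t = 0` the angle is close to `π / 2`, so its sine does not vanish there
  have hcont : ContinuousAt (fun t => Real.sin (θ a t)) 0 :=
    Real.continuous_sin.continuousAt.comp (hθ a 0 (by simp)).continuousAt
  have hne : ∀ᶠ t in nhdsWithin (0 : ℝ) (Ioi 0), Real.sin (θ a t) ≠ 0 :=
    (hcont.eventually_ne (by simp [h0])).filter_mono nhdsWithin_le_nhds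
  obtain ⟨t, ht1, ht2⟩ := (hne.and (Ioo_mem_nhdsGT zero_lt_one)).exists
  exact (hθ a).lt (hθ b) (by fun_prop) (fun t _ => by linarith) (by rw [h0, h0]) ht2
    (by linarith) ht1

theorem continuous_angle_one (hq : Continuous q) (hθ : ∀ a, IsAngle (fun t => q t + a) (θ a))
    (h0 : ∀ a, θ a 0 = Real.pi / 2) : Continuous fun a => θ a 1 := by
  obtain ⟨M, hM⟩ := isCompact_Icc.exists_bound_of_continuousOn (s := Icc (0 : ℝ) 1)
    (f := fun t => q t - 1) (by fun_prop)
  rw [continuous_iff_continuousAt]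
  intro a
  -- a Grönwall bound for the difference of the angles with parameters `b` and `a`
  have key : ∀ b, ‖θ a 1 - θ b 1‖ ≤ gronwallBound 0 (M + |a|) |a - b| (1 - 0) := fun b => by
    refine norm_le_gronwallBound_of_norm_deriv_right_le (f := fun t => θ a t - θ b t)
      ((hθ a).continuousOn.sub (hθ b).continuousOn)
      (fun t ht => ((hθ b).hasDerivAt_sub (hθ a) (Ico_subset_Icc_self ht)).hasDerivWithinAt)
      (by simp [h0]) (fun t ht => ?_) 1 (by simp)
    refine (norm_add_le _ _).trans (add_le_add ?_ ?_)
    · rw [norm_mul, norm_mul, norm_mul]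
      refine mul_le_mul_of_nonneg_right ?_ (norm_nonneg _)
      refine (mul_le_of_le_one_right (norm_nonneg _) (mul_le_one₀ (Real.abs_sin_le_one _)
        (norm_nonneg _) (Real.abs_sinc_le_one _))).trans ?_
      rw [add_sub_right_comm]
      exact (norm_add_le _ _).trans (add_le_add_left (hM t (Ico_subset_Icc_self ht)) _)
    · rw [add_sub_add_left_eq_sub, norm_mul]
      refine mul_le_of_le_one_right (norm_nonneg _) ?_
      rw [norm_pow]
      exact pow_le_one₀ (norm_nonneg _) (Real.abs_sin_le_one _)
  rw [ContinuousAt, tendsto_iff_norm_sub_tendsto_zero]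
  refine squeeze_zero (fun _ => norm_nonneg _) (fun b => (norm_sub_rev _ _).trans_le (key b)) ?_
  have hc : Continuous fun b => gronwallBound 0 (M + |a|) |a - b| (1 - 0) :=
    (gronwallBound_continuous_ε 0 (M + |a|) (1 - 0)).comp (by fun_prop)
  have := hc.tendsto a
  simpa only [sub_self, abs_zero, gronwallBound_ε0_δ0] using this

/-- For very negative parameters the angle stays below `3π / 4`, the constant angle which belongs to
the decaying solution of `z'' = z`. -/
theorem exists_angle_one_lt_pi (hq : Continuous q) (hθ : ∀ a, IsAngle (fun t => q t + a) (θ a))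
    (h0 : ∀ a, θ a 0 = Real.pi / 2) (A : ℝ) : ∃ a ≤ A, θ a 1 < Real.pi := by
  obtain ⟨M, hM⟩ := isCompact_Icc.exists_bound_of_continuousOn (s := Icc (0 : ℝ) 1)
    (f := q) (by fun_prop)
  have hπ := Real.pi_pos
  have hsin : Real.sin (3 * Real.pi / 4) ^ 2 = 1 / 2 := by
    rw [show 3 * Real.pi / 4 = Real.pi - Real.pi / 4 by ring, Real.sin_pi_sub,
      Real.sin_pi_div_four, div_pow, Real.sq_sqrt (by norm_num)]
    norm_num
  have hconst : IsAngle (fun _ => -1) (fun _ => 3 * Real.pi / 4) := fun t _ => by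
    convert! hasDerivAt_const t (3 * Real.pi / 4) using 1
    simp only [hsin]
    norm_num
  refine ⟨min A (-1 - M), min_le_left _ _, ?_⟩
  have := (hθ (min A (-1 - M))).le hconst continuous_const (fun t ht => ?_)
    (by rw [h0]; linarith) 1 (by simp)
  · linarith
  · have h1 := (abs_le.1 (hM t (Ioo_subset_Icc_self ht))).2
    have h2 := min_le_right A (-1 - M)
    linarith

/-- If the angle with parameter `0` ends between `n π` and `(n + 1) π`, then exactly `n` negative
parameters give an angle which ends at a multiple of `π`. -/
theorem encard_angle_one (hq : Continuous q) (hθ : ∀ a, IsAngle (fun t => q t + a) (θ a))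
    (h0 : ∀ a, θ a 0 = Real.pi / 2) {n : ℕ} (hn : n * Real.pi < θ 0 1)
    (hn' : θ 0 1 < (n + 1) * Real.pi) :
    {a : ℝ | a < 0 ∧ Real.sin (θ a 1) = 0}.encard = n := by
  have hπ := Real.pi_pos
  have hmono := strictMono_angle_one hq hθ h0
  have hcont := continuous_angle_one hq hθ h0
  have hex : ∀ k ∈ Icc 1 n, ∃ a < 0, θ a 1 = k * Real.pi := fun k hk => by
    obtain ⟨a₀, ha₀, h1⟩ := exists_angle_one_lt_pi hq hθ h0 0
    have hk1 : (1 : ℝ) ≤ k := by exact_mod_cast hk.1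
    have hk2 : (k : ℝ) ≤ n := by exact_mod_cast hk.2
    have hlt : k * Real.pi < θ 0 1 := (mul_le_mul_of_nonneg_right hk2 hπ.le).trans_lt hn
    have hle : θ a₀ 1 ≤ k * Real.pi := h1.le.trans (le_mul_of_one_le_left hπ.le hk1)
    -- `a₀` gives an end angle below `π ≤ k π`, the parameter `0` one above `n π ≥ k π`
    obtain ⟨a, ha, hak⟩ := intermediate_value_Icc ha₀ hcont.continuousOn ⟨hle, hlt.le⟩
    refine ⟨a, lt_of_le_of_ne ha.2 ?_, hak⟩
    rintro rfl
    exact hlt.ne' hak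
  choose! A hA0 hA using hex
  have hset : {a : ℝ | a < 0 ∧ Real.sin (θ a 1) = 0} = A '' Icc 1 n := by
    ext a
    constructor
    · rintro ⟨ha, hs⟩
      obtain ⟨k, hk⟩ := Real.sin_eq_zero_iff.1 hs
      have hpos : 0 < θ a 1 := (hθ a).pos_one (by fun_prop) (h0 a)
      have hk0 : 0 < k := by
        rw [← hk] at hpos
        exact_mod_cast pos_of_mul_pos_left hpos hπ.le
      have hkn : k < n + 1 := by
        have h1 : (k : ℝ) * Real.pi < (n + 1) * Real.pi := hk.trans_lt ((hmono ha).trans hn')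
        exact_mod_cast lt_of_mul_lt_mul_right h1 hπ.le
      lift k to ℕ using hk0.le
      have hkI : k ∈ Icc 1 n := ⟨by omega, by omega⟩
      exact ⟨k, hkI, hmono.injective ((hA k hkI).trans (by exact_mod_cast hk))⟩
    · rintro ⟨k, hk, rfl⟩
      exact ⟨hA0 k hk, by rw [hA k hk, Real.sin_nat_mul_pi]⟩
  have hinj : InjOn A (Icc 1 n) := fun k hk l hl hkl => by
    have h1 := (hA k hk).symm.trans ((congrArg (fun a => θ a 1) hkl).trans (hA l hl))
    exact_mod_cast mul_right_cancel₀ hπ.ne' h1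
  rw [hset, hinj.encard_image, ← Finset.coe_Icc, encard_coe_eq_coe_finsetCard, Nat.card_Icc]
  simp

end Counting

/-! ### Comparison of the nonlinear equation with its linearization -/

section Nonlinear

variable {f : ℝ → ℝ}

theorem apply_zero_of_mul_pos (hf : Continuous f) (hpos : ∀ s : ℝ, s ≠ 0 → 0 < s * f s) :
    f 0 = 0 := by
  apply le_antisymm
  · refine le_of_tendsto (hf.continuousWithinAt (s := Iio 0) (x := 0)) ?_
    filter_upwards [self_mem_nhdsWithin] with s hs
    exact (neg_of_mul_pos_right (hpos s (ne_of_lt hs)) (le_of_lt hs)).le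
  · refine ge_of_tendsto (hf.continuousWithinAt (s := Ioi 0) (x := 0)) ?_
    filter_upwards [self_mem_nhdsWithin] with s hs
    exact (pos_of_mul_pos_right (hpos s (ne_of_gt hs)) (le_of_lt hs)).le

theorem continuous_dslope_zero (hf : ContDiff ℝ 1 f) : Continuous (dslope f 0) := by
  rw [← continuousOn_univ, continuousOn_dslope Filter.univ_mem]
  exact ⟨hf.continuous.continuousOn, hf.differentiable (by simp) 0⟩

theorem dslope_zero_mul (hf0 : f 0 = 0) (s : ℝ) : dslope f 0 s * s = f s := by
  have := sub_smul_dslope f 0 s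
  rw [hf0, sub_zero, sub_zero, smul_eq_mul] at this
  linarith

theorem dslope_zero_lt_deriv (hf0 : f 0 = 0) (hf1 : ∀ s : ℝ, s ≠ 0 → f s / s < deriv f s) {s : ℝ}
    (hs : s ≠ 0) : dslope f 0 s < deriv f s := by
  have := hf1 s hs
  rwa [← dslope_zero_mul hf0 s, mul_div_cancel_right₀ _ hs] at this

theorem dslope_zero_le_deriv (hf0 : f 0 = 0) (hf1 : ∀ s : ℝ, s ≠ 0 → f s / s < deriv f s)
    (s : ℝ) : dslope f 0 s ≤ deriv f s := by
  by_cases hs : s = 0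
  · simp [hs]
  · exact (dslope_zero_lt_deriv hf0 hf1 hs).le

variable {U Y : ℝ → ℝ}

/-- A solution of `U'' = - f(U)` solves the linear equation with potential `f(U) / U`. -/
theorem isSol_dslope (hf0 : f 0 = 0) (hUc : ContinuousOn U (Icc 0 1))
    (hYc : ContinuousOn Y (Icc 0 1)) (hU : ∀ t ∈ Ioo (0 : ℝ) 1, HasDerivAt U (Y t) t)
    (hY : ∀ t ∈ Ioo (0 : ℝ) 1, HasDerivAt Y (-f (U t)) t) :
    IsSol (fun t => dslope f 0 (U t)) U Y :=
  ⟨hUc, hYc, hU, fun t ht => by rw [dslope_zero_mul hf0]; exact hY t ht⟩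

/-- The derivative of a solution of `U'' = - f(U)` solves the linearized equation. -/
theorem isSol_deriv (hf : ContDiff ℝ 1 f) (hUc : ContinuousOn U (Icc 0 1))
    (hYc : ContinuousOn Y (Icc 0 1)) (hU : ∀ t ∈ Ioo (0 : ℝ) 1, HasDerivAt U (Y t) t)
    (hY : ∀ t ∈ Ioo (0 : ℝ) 1, HasDerivAt Y (-f (U t)) t) :
    IsSol (fun t => deriv f (U t)) Y (fun t => -f (U t)) :=
  ⟨hYc, (hf.continuous.comp_continuousOn hUc).neg, hY, fun t ht =>
    ((hf.differentiable (by simp) (U t)).hasDerivAt.comp t (hU t ht)).neg⟩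

/-- The angle `θ` of the linearized equation is squeezed: it ends above the angle `φ` of `U` by
Sturm comparison of the potentials `f(U) / U < f'(U)`, and below `φ + π`, because it stays below the
angle of `U'`, which is in turn less than a half turn ahead of `φ`. -/
theorem angle_linearized_bounds (hf : ContDiff ℝ 1 f)
    (hf1 : ∀ s : ℝ, s ≠ 0 → f s / s < deriv f s) (hf3 : ∀ s : ℝ, s ≠ 0 → 0 < s * f s)
    (hUcont : Continuous U)
    (hYc : ContinuousOn Y (Icc 0 1)) (hU : ∀ t ∈ Ioo (0 : ℝ) 1, HasDerivAt U (Y t) t)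
    (hY : ∀ t ∈ Ioo (0 : ℝ) 1, HasDerivAt Y (-f (U t)) t) (hY0 : Y 0 = 0) (hU0 : U 0 ≠ 0)
    {φ θ : ℝ → ℝ} (hφ : IsAngle (fun t => dslope f 0 (U t)) φ) (hφ0 : φ 0 = Real.pi / 2)
    (hθ : IsAngle (fun t => deriv f (U t)) θ) (hθ0 : θ 0 = Real.pi / 2) :
    φ 1 < θ 1 ∧ θ 1 < φ 1 + Real.pi := by
  have hπ := Real.pi_pos
  have hf0 := apply_zero_of_mul_pos hf.continuous hf3
  have hpc : Continuous fun t => dslope f 0 (U t) := (continuous_dslope_zero hf).comp hUcont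
  have hqc : Continuous fun t => deriv f (U t) := (hf.continuous_deriv le_rfl).comp hUcont
  have hle : ∀ t ∈ Ioo (0 : ℝ) 1, dslope f 0 (U t) ≤ deriv f (U t) := fun t _ =>
    dslope_zero_le_deriv hf0 hf1 _
  obtain ⟨R, hR⟩ := hφ.exists_isRadius hpc
  have hUpol : ∀ t ∈ Icc (0 : ℝ) 1,
      U t = U 0 * (R t * Real.sin (φ t)) ∧ Y t = U 0 * (R t * Real.cos (φ t)) := fun t ht => by
    simpa [hφ0] using (isSol_dslope hf0 hUcont.continuousOn hYc hU hY).polar hpc hφ hR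
      (by simp [hφ0, hY0]) ht
  constructor
  · -- `U` is nonzero near `t = 0`
    have hne : ∀ᶠ t in nhdsWithin (0 : ℝ) (Ioi 0), U t ≠ 0 :=
      (hUcont.continuousAt.eventually_ne hU0).filter_mono nhdsWithin_le_nhds
    obtain ⟨t, ht1, ht2⟩ := (hne.and (Ioo_mem_nhdsGT zero_lt_one)).exists
    refine hφ.lt hθ hqc hle (by rw [hφ0, hθ0]) ht2 (dslope_zero_lt_deriv hf0 hf1 ht1) ?_
    intro hs
    rw [(hUpol t (Ioo_subset_Icc_self ht2)).1, hs] at ht1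
    simp at ht1
  · obtain ⟨ψ, hψ0, hψ⟩ := exists_isAngle hqc Real.pi
    obtain ⟨Q, hQ⟩ := hψ.exists_isRadius hqc
    have hYpol : ∀ t ∈ Icc (0 : ℝ) 1,
        Y t = f (U 0) * (Q t * Real.sin (ψ t)) ∧
          -f (U t) = f (U 0) * (Q t * Real.cos (ψ t)) := fun t ht => by
      simpa [hψ0] using (isSol_deriv hf hUcont.continuousOn hYc hU hY).polar hqc hψ hQ
        (by simp [hψ0, hY0]) ht
    have h1 : θ 1 < ψ 1 := hθ.lt_of_lt hψ hqc (fun _ _ => le_rfl)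
      (by rw [hθ0, hψ0]; linarith) 1 (by simp)
    -- up to a positive factor, the sine of the difference of the angles is `U' ^ 2 + U f(U)`
    have hsin : ∀ t ∈ Icc (0 : ℝ) 1, 0 < Real.sin (ψ t - φ t) := fun t ht => by
      obtain ⟨e1, e2⟩ := hUpol t ht
      obtain ⟨e3, e4⟩ := hYpol t ht
      have hid : (U 0 * f (U 0)) * (R t * Q t) * Real.sin (ψ t - φ t)
          = Y t ^ 2 + U t * f (U t) := by
        rw [Real.sin_sub]
        linear_combination -(Y t) * e2 - (U 0 * (R t * Real.cos (φ t))) * e3 + (-f (U t)) * e1 +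
          (U 0 * (R t * Real.sin (φ t))) * e4
      have hpos : 0 < Y t ^ 2 + U t * f (U t) := by
        by_cases hUt : U t = 0
        · have hs : Real.sin (φ t) = 0 := by
            have := (hR.pos t).ne'
            rw [hUt] at e1
            simpa [hU0, this] using e1
          have hc : Real.cos (φ t) ≠ 0 := fun hc => by
            have := Real.sin_sq_add_cos_sq (φ t)
            rw [hs, hc] at this
            norm_num at this
          have : Y t ≠ 0 := by
            rw [e2]
            exact mul_ne_zero hU0 (mul_ne_zero (hR.pos t).ne' hc)
          rw [hUt, zero_mul, add_zero]
          positivity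
        · exact add_pos_of_nonneg_of_pos (sq_nonneg _) (hf3 _ hUt)
      rw [← hid] at hpos
      exact pos_of_mul_pos_right hpos
        (mul_pos (hf3 _ hU0) (mul_pos (hR.pos t) (hQ.pos t))).le
    have h2 : ψ 1 - φ 1 < Real.pi := by
      by_contra hcon
      obtain ⟨t, ht, htπ⟩ := intermediate_value_Icc (zero_le_one (α := ℝ))
        (hψ.continuousOn.sub hφ.continuousOn)
        (show Real.pi ∈ Icc (ψ 0 - φ 0) (ψ 1 - φ 1) from
          ⟨by rw [hψ0, hφ0]; linarith, not_lt.1 hcon⟩)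
      have := hsin t ht
      rw [show ψ t - φ t = Real.pi from htπ, Real.sin_pi] at this
      exact lt_irrefl _ this
    linarith

end Nonlinear

/-! ### One-dimensional Sobolev functions vanishing at `1` -/

/-- The primitive of `G` which vanishes at `1`. For `G ∈ L²(0, 1)` these are the functions of
`H¹(0, 1)` which vanish at `1`. -/
def prim (G : ℝ → ℝ) (s : ℝ) : ℝ := ∫ t in (1 : ℝ)..s, G t

@[simp] theorem prim_one (G : ℝ → ℝ) : prim G 1 = 0 := intervalIntegral.integral_same

theorem continuous_prim {G : ℝ → ℝ} (hG : Integrable G) : Continuous (prim G) :=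
  hG.continuous_primitive 1

theorem prim_congr {G H : ℝ → ℝ} (h : G =ᵐ[volume.restrict (Ioo 0 1)] H) {s : ℝ}
    (hs : s ∈ Icc (0 : ℝ) 1) : prim G s = prim H s := by
  unfold prim
  refine intervalIntegral.integral_congr_ae_restrict ?_
  rw [uIoc_of_ge hs.2]
  rw [restrict_Ioo_eq_restrict_Ioc] at h
  exact ae_restrict_of_ae_restrict_of_subset (Ioc_subset_Ioc_left hs.1) h

theorem integral_Ioo_eq {F : ℝ → ℝ} : ∫ s in Ioo (0 : ℝ) 1, F s = ∫ s in (0 : ℝ)..1, F s := by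
  rw [intervalIntegral.integral_of_le zero_le_one, integral_Ioc_eq_integral_Ioo]

/-- Integration by parts against a `C¹` function vanishing at `0`. -/
theorem integral_mul_prim {P p G : ℝ → ℝ} (hP : ∀ t ∈ Icc (0 : ℝ) 1, HasDerivAt P (p t) t)
    (hp : ContinuousOn p (Icc 0 1)) (hP0 : P 0 = 0) (hG : Integrable G) :
    ∫ s in Ioo (0 : ℝ) 1, prim G s * p s = - ∫ s in Ioo (0 : ℝ) 1, G s * P s := by
  have hu : uIcc (0 : ℝ) 1 = Icc 0 1 := uIcc_of_le zero_le_one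
  have hPac : AbsolutelyContinuousOnInterval P 0 1 := by
    apply ContDiffOn.absolutelyContinuousOnInterval
    rw [hu, contDiffOn_one_iff_derivWithin (uniqueDiffOn_Icc zero_lt_one)]
    exact ⟨fun t ht => (hP t ht).differentiableAt.differentiableWithinAt,
      hp.congr fun t ht => (hP t ht).hasDerivWithinAt.derivWithin
        (uniqueDiffOn_Icc zero_lt_one t ht)⟩
  have hGac : AbsolutelyContinuousOnInterval (prim G) 0 1 :=
    hG.intervalIntegrable.absolutelyContinuousOnInterval_intervalIntegral (by simp)
  have h := hGac.integral_mul_deriv_eq_deriv_mul hPac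
  rw [hP0, prim_one, mul_zero, zero_mul, sub_zero, zero_sub] at h
  rw [integral_Ioo_eq, integral_Ioo_eq]
  convert! h using 1
  · refine intervalIntegral.integral_congr fun t ht => ?_
    rw [hu] at ht
    simp only [(hP t ht).deriv]
  · congr 1
    refine intervalIntegral.integral_congr_ae ?_
    filter_upwards [LocallyIntegrable.ae_hasDerivAt_integral hG.locallyIntegrable] with t ht _
    rw [show deriv (prim G) t = G t from (ht 1).deriv]

/-- A test function in `C_c^∞(0, 1)` has a primitive on `(0, 1)` which extends to a test function in
`C_c^∞(0, ∞)`. -/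
theorem exists_test_primitive {η : ℝ → ℝ} (hη : ContDiff ℝ (⊤ : ℕ∞) η) (hc : HasCompactSupport η)
    (hs : tsupport η ⊆ Ioo 0 1) :
    ∃ ψ : ℝ → ℝ, ContDiff ℝ (⊤ : ℕ∞) ψ ∧ HasCompactSupport ψ ∧ tsupport ψ ⊆ Ioi 0 ∧
      ∀ t ∈ Ioo (0 : ℝ) 1, deriv ψ t = η t := by
  obtain ⟨ε, hε, hηε⟩ : ∃ ε > 0, ∀ t < ε, η t = 0 := by
    by_cases hne : (tsupport η).Nonempty
    · obtain ⟨m, hm, hmin⟩ := hc.isCompact.exists_isLeast hne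
      refine ⟨m, (hs hm).1, fun t ht => ?_⟩
      by_contra h
      exact absurd (hmin (subset_tsupport _ h)) (not_le.2 ht)
    · refine ⟨1, one_pos, fun t _ => ?_⟩
      by_contra h
      exact hne ⟨t, subset_tsupport _ h⟩
  have hder : ∀ t, HasDerivAt (fun t => ∫ r in (0 : ℝ)..t, η r) (η t) t := fun t =>
    (hη.continuous.integral_hasStrictDerivAt 0 t).hasDerivAt
  have hsm : ContDiff ℝ (⊤ : ℕ∞) (fun t => ∫ r in (0 : ℝ)..t, η r) := by
    rw [contDiff_infty_iff_deriv]
    refine ⟨fun t => (hder t).differentiableAt, ?_⟩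
    rwa [show deriv (fun t => ∫ r in (0 : ℝ)..t, η r) = η from funext fun t => (hder t).deriv]
  let b : ContDiffBump (0 : ℝ) := ⟨2, 3, by norm_num, by norm_num⟩
  have hb : ∀ t ∈ Ioo (0 : ℝ) 1, ∀ᶠ s in nhds t, b s = 1 := fun t ht => by
    filter_upwards [Ioo_mem_nhds ht.1 ht.2] with s hs
    refine b.one_of_mem_closedBall ?_
    rw [mem_closedBall_zero_iff, Real.norm_eq_abs, abs_of_pos hs.1]
    exact hs.2.le.trans (by norm_num [b])
  refine ⟨fun t => b t * ∫ r in (0 : ℝ)..t, η r, b.contDiff.mul hsm, b.hasCompactSupport.mul_right,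
    ?_, fun t ht => ?_⟩
  · refine Subset.trans (closure_minimal ?_ isClosed_Ici) (Ici_subset_Ioi.2 hε)
    intro t ht
    by_contra hlt
    refine ht ?_
    have : ∫ r in (0 : ℝ)..t, η r = 0 := by
      rw [intervalIntegral.integral_congr (g := fun _ => 0) fun r hr => ?_]
      · simp
      · refine hηε r (hr.2.trans_lt (max_lt hε (not_le.1 hlt)))
    simp [this]
  · have : (fun t => b t * ∫ r in (0 : ℝ)..t, η r) =ᶠ[nhds t] fun t => ∫ r in (0 : ℝ)..t, η r := by
      filter_upwards [hb t ht] with s hs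
      rw [hs, one_mul]
    rw [this.deriv_eq, (hder t).deriv]

/-- The du Bois-Reymond lemma; the test functions which do not vanish at `1` encode the boundary
condition `V 1 = 0`. -/
theorem ae_eq_prim {V G : ℝ → ℝ} (hV : IntegrableOn V (Ioo 0 1)) (hG : Integrable G)
    (h : ∀ ψ : ℝ → ℝ, ContDiff ℝ (⊤ : ℕ∞) ψ → HasCompactSupport ψ → tsupport ψ ⊆ Ioi 0 →
      ∫ s in Ioo (0 : ℝ) 1, V s * deriv ψ s = - ∫ s in Ioo (0 : ℝ) 1, G s * ψ s) :
    V =ᵐ[volume.restrict (Ioo 0 1)] prim G := by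
  have hW : IntegrableOn (prim G) (Ioo 0 1) :=
    ((continuous_prim hG).integrableOn_Icc (a := 0) (b := 1)).mono_set Ioo_subset_Icc_self
  have key := isOpen_Ioo.ae_eq_zero_of_integral_contDiff_smul_eq_zero (μ := volume)
    (f := fun s => V s - prim G s) (hV.sub hW).locallyIntegrableOn (fun η hη hc hs => ?_)
  · filter_upwards [(ae_restrict_iff' measurableSet_Ioo).2 key] with s hs
    exact sub_eq_zero.1 hs
  · obtain ⟨ψ, hψ, hψc, hψs, hψd⟩ := exists_test_primitive hη hc hs
    have hd : ∀ t, HasDerivAt ψ (deriv ψ t) t := fun t =>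
      (hψ.differentiable (by simp) t).hasDerivAt
    have hdc : Continuous (deriv ψ) := hψ.continuous_deriv (by simp)
    have hψ0 : ψ 0 = 0 := image_eq_zero_of_notMem_tsupport fun h0 => lt_irrefl (0 : ℝ) (hψs h0)
    have h1 := h ψ hψ hψc hψs
    have h2 := integral_mul_prim (fun t _ => hd t) hdc.continuousOn hψ0 hG
    obtain ⟨C, hC⟩ := hψc.deriv.exists_bound_of_continuous hdc
    have i1 : IntegrableOn (fun s => V s * deriv ψ s) (Ioo 0 1) :=
      hV.mul_bdd hdc.aestronglyMeasurable (.of_forall hC)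
    have i2 : IntegrableOn (fun s => prim G s * deriv ψ s) (Ioo 0 1) :=
      hW.mul_bdd hdc.aestronglyMeasurable (.of_forall hC)
    rw [← setIntegral_eq_integral_of_forall_compl_eq_zero (s := Ioo 0 1) fun t ht => by
        rw [image_eq_zero_of_notMem_tsupport fun h0 => ht (hs h0), zero_smul]]
    rw [setIntegral_congr_fun (g := fun s => V s * deriv ψ s - prim G s * deriv ψ s)
      measurableSet_Ioo fun t ht => by simp only [hψd t ht, smul_eq_mul]; ring,
      integral_sub i1 i2, h1, h2, sub_self]

theorem memLp_of_continuous {F : ℝ → ℝ} (hF : Continuous F) :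
    MemLp F 2 (volume.restrict (Ioo 0 1)) := by
  obtain ⟨C, hC⟩ := isCompact_Icc.exists_bound_of_continuousOn (s := Icc (0 : ℝ) 1)
    (f := F) hF.continuousOn
  exact MemLp.of_bound hF.aestronglyMeasurable C
    ((ae_restrict_iff' measurableSet_Ioo).2 (.of_forall fun t ht => hC t (Ioo_subset_Icc_self ht)))

/-- The one-dimensional weak equation `w'' = - p`, `w' 0 = 0` for `w = prim G`, in integrated
form. -/
theorem ae_eq_neg_integral {G p : ℝ → ℝ} (hG : Integrable G)
    (hG2 : MemLp G 2 (volume.restrict (Ioo 0 1))) (hp : Continuous p)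
    (h : ∀ H : ℝ → ℝ, Integrable H → MemLp H 2 (volume.restrict (Ioo 0 1)) →
      ∫ s in Ioo (0 : ℝ) 1, G s * H s = ∫ s in Ioo (0 : ℝ) 1, p s * prim H s) :
    G =ᵐ[volume.restrict (Ioo 0 1)] fun t => - ∫ s in (0 : ℝ)..t, p s := by
  set P : ℝ → ℝ := fun t => ∫ s in (0 : ℝ)..t, p s with hPdef
  have hP : ∀ t, HasDerivAt P (p t) t := fun t => (hp.integral_hasStrictDerivAt 0 t).hasDerivAt
  have hPc : Continuous P := continuous_iff_continuousAt.2 fun t => (hP t).continuousAt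
  have hP2 := memLp_of_continuous hPc
  -- after an integration by parts the choice `H = G + P` gives `∫ (G + P) ^ 2 = 0`
  set H : ℝ → ℝ := (Ioo (0 : ℝ) 1).indicator fun t => G t + P t with hH
  have hHeq : ∀ t ∈ Ioo (0 : ℝ) 1, H t = G t + P t := fun t ht => indicator_of_mem ht _
  have hH2 : MemLp H 2 (volume.restrict (Ioo 0 1)) :=
    (hG2.add hP2).ae_eq ((ae_restrict_iff' measurableSet_Ioo).2
      (.of_forall fun t ht => (hHeq t ht).symm))
  have hHi : Integrable H := (integrable_indicator_iff measurableSet_Ioo).2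
    ((hG.integrableOn).add ((hPc.integrableOn_Icc (a := 0) (b := 1)).mono_set
      Ioo_subset_Icc_self))
  have h1 := h H hHi hH2
  have h2 := integral_mul_prim (fun t _ => hP t) hp.continuousOn (by simp [P]) hHi
  simp_rw [mul_comm (prim H _)] at h2
  rw [h2] at h1
  have i1 : IntegrableOn (fun s => G s * H s) (Ioo 0 1) := hG2.integrable_mul hH2
  have i2 : IntegrableOn (fun s => H s * P s) (Ioo 0 1) := hH2.integrable_mul hP2
  have h3 : ∫ s in Ioo (0 : ℝ) 1, (G s + P s) ^ 2 = 0 := by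
    rw [setIntegral_congr_fun (g := fun s => G s * H s + H s * P s) measurableSet_Ioo
      fun t ht => by simp only [hHeq t ht]; ring, integral_add i1 i2, h1]
    ring
  have i3 : IntegrableOn (fun s => (G s + P s) ^ 2) (Ioo 0 1) := (hG2.add hP2).integrable_sq
  rw [integral_eq_zero_iff_of_nonneg (fun _ => sq_nonneg _) i3] at h3
  filter_upwards [h3] with t ht
  have : G t + P t = 0 := pow_eq_zero_iff two_ne_zero |>.1 ht
  linarith

/-! ### One-dimensional functions on the cylinder -/

section Cylinder

variable {ω : Set (EuclideanSpace ℝ (Fin d))}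

theorem volume_restrict_cylinder (ω : Set (EuclideanSpace ℝ (Fin d))) :
    volume.restrict (cylinder ω) =
      (volume.restrict ω).prod (volume.restrict (Ioo (0 : ℝ) 1)) := by
  rw [Measure.prod_restrict]; rfl

theorem IsSmoothBoundedDomain.isFiniteMeasure (hω : IsSmoothBoundedDomain ω) :
    IsFiniteMeasure (volume.restrict ω) :=
  isFiniteMeasure_restrict.2 hω.isBounded.measure_lt_top.ne

theorem IsSmoothBoundedDomain.restrict_ne_zero (hω : IsSmoothBoundedDomain ω) :
    (volume.restrict ω : Measure (EuclideanSpace ℝ (Fin d))) ≠ 0 := by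
  rw [Ne, Measure.restrict_eq_zero]
  exact (hω.isOpen.measure_pos volume hω.isConnected.nonempty).ne'

theorem IsSmoothBoundedDomain.isOpen_cylinder (hω : IsSmoothBoundedDomain ω) :
    IsOpen (cylinder ω) := hω.isOpen.prod isOpen_Ioo

theorem IsSmoothBoundedDomain.measureReal_pos (hω : IsSmoothBoundedDomain ω) :
    0 < volume.real ω :=
  ENNReal.toReal_pos (hω.isOpen.measure_pos volume hω.isConnected.nonempty).ne'
    hω.isBounded.measure_lt_top.ne

theorem integral_cylinder_snd (ω : Set (EuclideanSpace ℝ (Fin d))) (F : ℝ → ℝ) :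
    ∫ x in cylinder ω, F x.2 = volume.real ω * ∫ s in Ioo (0 : ℝ) 1, F s := by
  rw [volume_restrict_cylinder, integral_fun_snd]
  simp

theorem ae_cylinder_of_ae {P : ℝ → Prop} (h : ∀ᵐ s ∂(volume.restrict (Ioo (0 : ℝ) 1)), P s) :
    ∀ᵐ x ∂(volume.restrict (cylinder ω)), P x.2 := by
  rw [volume_restrict_cylinder]
  exact Measure.quasiMeasurePreserving_snd.ae h

theorem IsSmoothBoundedDomain.ae_of_ae_cylinder (hω : IsSmoothBoundedDomain ω) {P : ℝ → Prop}
    (h : ∀ᵐ x ∂(volume.restrict (cylinder ω)), P x.2) :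
    ∀ᵐ s ∂(volume.restrict (Ioo (0 : ℝ) 1)), P s := by
  rw [volume_restrict_cylinder] at h
  have h1 := Measure.ae_ae_of_ae_prod h
  have : (ae (volume.restrict ω)).NeBot := ae_neBot.2 hω.restrict_ne_zero
  obtain ⟨y, hy⟩ := h1.exists
  exact hy

theorem IsSmoothBoundedDomain.memLp_snd_iff (hω : IsSmoothBoundedDomain ω) {G : ℝ → ℝ} :
    MemLp (fun x : Space d => G x.2) 2 (volume.restrict (cylinder ω)) ↔
      MemLp G 2 (volume.restrict (Ioo (0 : ℝ) 1)) := by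
  have := hω.isFiniteMeasure
  rw [volume_restrict_cylinder]
  refine ⟨fun h => ?_, fun h => h.comp_snd _⟩
  have h1 : AEStronglyMeasurable G (volume.restrict (Ioo (0 : ℝ) 1)) :=
    (AEStronglyMeasurable.comp_snd_iff hω.restrict_ne_zero).1 h.1
  rw [memLp_two_iff_integrable_sq h1]
  exact (Integrable.comp_snd_iff (f := fun s => G s ^ 2) hω.restrict_ne_zero).1 h.integrable_sq

theorem IsSmoothBoundedDomain.isFiniteMeasure_cylinder (hω : IsSmoothBoundedDomain ω) :
    IsFiniteMeasure (volume.restrict (cylinder ω)) := by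
  have := hω.isFiniteMeasure
  rw [volume_restrict_cylinder]
  infer_instance

theorem hasDerivAt_snd {φ : Space d → ℝ} (hφ : Differentiable ℝ φ)
    (y : EuclideanSpace ℝ (Fin d)) (s : ℝ) :
    HasDerivAt (fun t => φ (y, t)) (fderiv ℝ φ (y, s) (0, 1)) s :=
  (hφ (y, s)).hasFDerivAt.comp_hasDerivAt s ((hasDerivAt_const s y).prodMk (hasDerivAt_id s))

theorem fderiv_fst {φ : Space d → ℝ} (hφ : Differentiable ℝ φ)
    (y e : EuclideanSpace ℝ (Fin d)) (s : ℝ) :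
    fderiv ℝ (fun y => φ (y, s)) y e = fderiv ℝ φ (y, s) (e, 0) := by
  have h := (hφ (y, s)).hasFDerivAt.comp y
    ((hasFDerivAt_id (𝕜 := ℝ) y).prodMk (hasFDerivAt_const (𝕜 := ℝ) s y))
  have h' : HasFDerivAt (fun y => φ (y, s)) _ y := h
  rw [h'.fderiv]
  simp

theorem IsTest.differentiable {V : Set (Space d)} {φ : Space d → ℝ} (h : IsTest V φ) :
    Differentiable ℝ φ := h.smooth.differentiable (by simp)

theorem IsTest.eq_zero {V : Set (Space d)} {φ : Space d → ℝ} (h : IsTest V φ) {x : Space d}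
    (hx : x ∉ V) : φ x = 0 :=
  image_eq_zero_of_notMem_tsupport fun h0 => hx (h.subset h0)

theorem IsTest.mono {V W : Set (Space d)} {φ : Space d → ℝ} (h : IsTest V φ) (hVW : V ⊆ W) :
    IsTest W φ := ⟨h.smooth, h.compact, h.subset.trans hVW⟩

theorem cylinder_subset_halfCylinder : cylinder ω ⊆ halfCylinder ω :=
  prod_mono_right Ioo_subset_Ioi_self

theorem IsSmoothBoundedDomain.integrable_snd (hω : IsSmoothBoundedDomain ω) {G : ℝ → ℝ}
    (hG : Integrable G) : Integrable (fun x : Space d => G x.2) (volume.restrict (cylinder ω)) := by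
  have := hω.isFiniteMeasure
  rw [volume_restrict_cylinder]
  exact hG.integrableOn.comp_snd _

theorem IsTest.integrable_mul {V : Set (Space d)} {μ : Measure (Space d)} {φ F : Space d → ℝ}
    (hφ : IsTest V φ) (hF : Integrable F μ) : Integrable (fun x => F x * φ x) μ := by
  obtain ⟨C, hC⟩ := hφ.compact.exists_bound_of_continuous hφ.smooth.continuous
  exact hF.mul_bdd hφ.smooth.continuous.aestronglyMeasurable (.of_forall hC)

/-- Green's formula in the last variable for a one-dimensional function. -/
theorem IsSmoothBoundedDomain.integral_prim_mul_fderiv (hω : IsSmoothBoundedDomain ω) {G : ℝ → ℝ}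
    (hG : Integrable G) {φ : Space d → ℝ} (hφ : IsTest (halfCylinder ω) φ) :
    ∫ x in cylinder ω, prim G x.2 * fderiv ℝ φ x (0, 1) =
      - ∫ x in cylinder ω, G x.2 * φ x := by
  have i1 := integrable_mul_of (hω.memLp_snd_iff.2 (memLp_of_continuous (continuous_prim hG)))
    (hφ.memLp_fderiv (0, 1) (volume.restrict (cylinder ω)))
  have i2 := hφ.integrable_mul (hω.integrable_snd hG)
  rw [volume_restrict_cylinder] at i1 i2 ⊢
  rw [integral_prod _ i1, integral_prod _ i2, ← integral_neg]
  refine integral_congr_ae (.of_forall fun y => ?_)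
  refine integral_mul_prim (P := fun t => φ (y, t))
    (fun t _ => hasDerivAt_snd hφ.differentiable y t) ?_ (hφ.eq_zero fun h => lt_irrefl (0 : ℝ) h.2)
    hG
  have hc : Continuous fun x : Space d => fderiv ℝ φ x (0, 1) :=
    (hφ.smooth.continuous_fderiv (by simp)).clm_apply continuous_const
  exact (hc.comp (Continuous.prodMk_right y)).continuousOn

/-- A function of `x_N` alone has vanishing weak derivatives in the other directions. -/
theorem IsSmoothBoundedDomain.integral_mul_fderiv_fst (hω : IsSmoothBoundedDomain ω) {F : ℝ → ℝ}
    (hF : MemLp F 2 (volume.restrict (Ioo 0 1))) {φ : Space d → ℝ}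
    (hφ : IsTest (cylinder ω) φ) (e : EuclideanSpace ℝ (Fin d)) :
    ∫ x in cylinder ω, F x.2 * fderiv ℝ φ x (e, 0) = 0 := by
  have i1 := integrable_mul_of (hω.memLp_snd_iff.2 hF)
    (hφ.memLp_fderiv (e, 0) (volume.restrict (cylinder ω)))
  rw [volume_restrict_cylinder] at i1 ⊢
  rw [integral_prod_symm _ i1]
  refine (integral_congr_ae (.of_forall fun s => ?_)).trans (integral_zero _ _)
  simp only [integral_const_mul]
  have hsl : ContDiff ℝ (⊤ : ℕ∞) fun y => φ (y, s) := hφ.smooth.comp (contDiff_prodMk_left s)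
  have hcs : HasCompactSupport fun y => φ (y, s) := by
    refine HasCompactSupport.intro (hφ.compact.isCompact.image continuous_fst) fun y hy => ?_
    exact image_eq_zero_of_notMem_tsupport fun h => hy ⟨_, h, rfl⟩
  have hfd : ∀ y, fderiv ℝ φ (y, s) (e, 0) = fderiv ℝ (fun y => φ (y, s)) y e := fun y =>
    (fderiv_fst hφ.differentiable y e s).symm
  have hz : ∀ y, y ∉ ω → fderiv ℝ φ (y, s) (e, 0) = 0 := fun y hy => by
    have : (y, s) ∉ tsupport (fderiv ℝ φ) := fun h =>
      hy (hφ.subset (tsupport_fderiv_subset ℝ h)).1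
    rw [image_eq_zero_of_notMem_tsupport this]
    rfl
  rw [setIntegral_eq_integral_of_forall_compl_eq_zero fun y hy => hz y hy]
  have h0 : ∫ y, fderiv ℝ (fun y => φ (y, s)) y e = 0 := by
    have hint : Integrable fun y => fderiv ℝ (fun y => φ (y, s)) y e :=
      ((hsl.continuous_fderiv (by simp)).clm_apply continuous_const).integrable_of_hasCompactSupport
        (hcs.fderiv_apply ℝ e)
    have := integral_mul_fderiv_eq_neg_fderiv_mul_of_integrable (μ := volume)
      (f := fun _ => (1 : ℝ)) (g := fun y => φ (y, s)) (v := e) (by simp) (by simpa using hint)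
      (by simpa using hsl.continuous.integrable_of_hasCompactSupport hcs) (by simp)
      (fun y _ => hsl.differentiable (by simp) y)
    simpa using this
  simp only [hfd, h0, mul_zero]

/-- One-dimensional functions `x ↦ w(x_N)` with `w ∈ H¹(0, 1)`, `w 1 = 0`, belong to
`H_0^1(Ω_ω ∪ Γ)`. -/
theorem IsSmoothBoundedDomain.inH10_prim (hω : IsSmoothBoundedDomain ω) {G : ℝ → ℝ}
    (hG : Integrable G) (hG2 : MemLp G 2 (volume.restrict (Ioo 0 1))) :
    InH10 ω (fun x => prim G x.2) (fun x => (0, G x.2)) := by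
  have hW2 := memLp_of_continuous (continuous_prim hG)
  refine ⟨hω.memLp_snd_iff.2 hW2, ?_, fun φ hφ e => ?_, MemLp.zero, fun φ hφ => ?_⟩
  · exact memLp_prod_iff.2 ⟨MemLp.zero, hω.memLp_snd_iff.2 hG2⟩
  · have i1 := integrable_mul_of (hω.memLp_snd_iff.2 hW2)
      (hφ.memLp_fderiv (e.1, 0) (volume.restrict (cylinder ω)))
    have i2 := integrable_mul_of (hω.memLp_snd_iff.2 hW2)
      (hφ.memLp_fderiv (0, 1) (volume.restrict (cylinder ω)))
    have he : ∀ x, prim G x.2 * fderiv ℝ φ x e =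
        prim G x.2 * fderiv ℝ φ x (e.1, 0) + e.2 * (prim G x.2 * fderiv ℝ φ x (0, 1)) := by
      intro x
      have : e = (e.1, 0) + e.2 • ((0, 1) : Space d) := by ext <;> simp
      conv_lhs => rw [this, map_add, map_smul]
      simp only [smul_eq_mul]
      ring
    simp only [he]
    rw [integral_add i1 (i2.const_mul _), hω.integral_mul_fderiv_fst hW2 hφ, integral_const_mul,
      hω.integral_prim_mul_fderiv hG (hφ.mono cylinder_subset_halfCylinder), zero_add,
      mul_neg, ← integral_const_mul]
    simp only [dot, inner_zero_left, zero_add]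
    congr 2
    ext x
    ring
  · rw [hω.integral_prim_mul_fderiv hG hφ]
    simp

theorem exists_bump_integral_one {V : Set (EuclideanSpace ℝ (Fin d))} (hV : IsOpen V)
    (hne : V.Nonempty) : ∃ χ : EuclideanSpace ℝ (Fin d) → ℝ, ContDiff ℝ (⊤ : ℕ∞) χ ∧
      HasCompactSupport χ ∧ tsupport χ ⊆ V ∧ ∫ y in V, χ y = 1 := by
  obtain ⟨y, hy⟩ := hne
  obtain ⟨χ, h1, h2, h3, h4, h5⟩ := exists_contDiff_tsupport_subset (n := ⊤) (hV.mem_nhds hy)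
  have hpos : 0 < ∫ y, χ y := h3.continuous.integral_pos_of_hasCompactSupport_nonneg_nonzero h2
    (fun z => (h4 ⟨z, rfl⟩).1) (by rw [h5]; exact one_ne_zero)
  have hint : ∫ y in V, χ y = ∫ y, χ y := setIntegral_eq_integral_of_forall_compl_eq_zero
    fun z hz => image_eq_zero_of_notMem_tsupport fun h => hz (h1 h)
  refine ⟨fun z => (∫ y, χ y)⁻¹ * χ z, contDiff_const.mul h3, h2.mul_left,
    (closure_mono (Function.support_mul_subset_right _ _)).trans h1, ?_⟩
  rw [integral_const_mul, hint, inv_mul_cancel₀ hpos.ne']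

theorem isTest_mul {ω : Set (EuclideanSpace ℝ (Fin d))} {χ : EuclideanSpace ℝ (Fin d) → ℝ}
    {ψ : ℝ → ℝ} (hχ : ContDiff ℝ (⊤ : ℕ∞) χ) (hχc : HasCompactSupport χ) (hχs : tsupport χ ⊆ ω)
    (hψ : ContDiff ℝ (⊤ : ℕ∞) ψ) (hψc : HasCompactSupport ψ) (hψs : tsupport ψ ⊆ Ioi 0) :
    IsTest (halfCylinder ω) fun x => χ x.1 * ψ x.2 := by
  have hz : ∀ x : Space d, x ∉ tsupport χ ×ˢ tsupport ψ → χ x.1 * ψ x.2 = 0 := fun x hx => by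
    by_contra h
    exact hx ⟨subset_tsupport _ (left_ne_zero_of_mul h), subset_tsupport _ (right_ne_zero_of_mul h)⟩
  refine ⟨(hχ.comp contDiff_fst).mul (hψ.comp contDiff_snd),
    HasCompactSupport.intro (hχc.isCompact.prod hψc.isCompact) hz, ?_⟩
  refine Subset.trans (closure_minimal (fun x hx => ?_)
    ((isClosed_tsupport χ).prod (isClosed_tsupport ψ))) (prod_mono hχs hψs)
  by_contra h
  exact hx (hz x h)

/-- The one-dimensional functions of `H_0^1(Ω_ω ∪ Γ)` are the functions `x ↦ w(x_N)` with
`w ∈ H¹(0, 1)`, `w 1 = 0`. -/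
theorem IsSmoothBoundedDomain.exists_prim (hω : IsSmoothBoundedDomain ω) {v : Space d → ℝ}
    {g : Space d → Space d} (hv : InH10 ω v g) (h1 : IsOneDim ω v) :
    ∃ G : ℝ → ℝ, Integrable G ∧ MemLp G 2 (volume.restrict (Ioo 0 1)) ∧
      (∀ᵐ x ∂(volume.restrict (cylinder ω)), v x = prim G x.2) ∧
      ∀ᵐ x ∂(volume.restrict (cylinder ω)), (g x).2 = G x.2 := by
  have := hω.isFiniteMeasure
  have := hω.isFiniteMeasure_cylinder
  -- nothing is assumed on `V`, whose integrability comes from that of `v`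
  obtain ⟨V, hV⟩ := h1
  have hVint : IntegrableOn V (Ioo 0 1) := by
    have h2 := (hv.memLp.integrable one_le_two).congr hV
    rw [volume_restrict_cylinder] at h2
    exact (Integrable.comp_snd_iff hω.restrict_ne_zero).1 h2
  obtain ⟨χ, hχ, hχc, hχs, hχ1⟩ := exists_bump_integral_one hω.isOpen hω.isConnected.nonempty
  have hg2 : MemLp (fun x => (g x).2) 2 (volume.restrict (cylinder ω)) := hv.memLp_grad.snd
  -- `G` is a weighted average of the last component of the gradient over the cross-section
  set G : ℝ → ℝ := (Ioo (0 : ℝ) 1).indicator fun s => ∫ y in ω, χ y * (g (y, s)).2 with hGdef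
  obtain ⟨C, hC⟩ := hχc.exists_bound_of_continuous hχ.continuous
  have hχg : Integrable (fun x : Space d => χ x.1 * (g x).2)
      ((volume.restrict ω).prod (volume.restrict (Ioo (0 : ℝ) 1))) := by
    rw [← volume_restrict_cylinder]
    exact (hg2.integrable one_le_two).bdd_mul
      (hχ.continuous.comp continuous_fst).aestronglyMeasurable (.of_forall fun x => hC x.1)
  have hG : Integrable G :=
    (integrable_indicator_iff measurableSet_Ioo).2 hχg.integral_prod_right
  have hVG : V =ᵐ[volume.restrict (Ioo 0 1)] prim G := by
    refine ae_eq_prim hVint hG fun ψ hψ hψc hψs => ?_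
    have hφ := isTest_mul hχ hχc hχs hψ hψc hψs
    have htr := hv.trace.2 _ hφ
    have hd : ∀ x : Space d, fderiv ℝ (fun x : Space d => χ x.1 * ψ x.2) x (0, 1) =
        χ x.1 * deriv ψ x.2 := fun x =>
      (hasDerivAt_snd hφ.differentiable x.1 x.2).unique
        ((hψ.differentiable (by simp) x.2).hasDerivAt.const_mul (χ x.1))
    have e1 : ∫ x in cylinder ω, v x * fderiv ℝ (fun x : Space d => χ x.1 * ψ x.2) x (0, 1) =
        ∫ s in Ioo (0 : ℝ) 1, V s * deriv ψ s := by
      rw [integral_congr_ae (g := fun x : Space d => χ x.1 * (V x.2 * deriv ψ x.2)),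
        volume_restrict_cylinder, integral_prod_mul χ fun s => V s * deriv ψ s, hχ1, one_mul]
      filter_upwards [hV] with x hx
      rw [hx, hd]
      ring
    have e2 : ∫ x in cylinder ω, (g x).2 * (χ x.1 * ψ x.2) =
        ∫ s in Ioo (0 : ℝ) 1, G s * ψ s := by
      have i := integrable_mul_of hg2 (hφ.memLp (volume.restrict (cylinder ω)))
      rw [volume_restrict_cylinder] at i ⊢
      rw [integral_prod_symm _ i]
      refine setIntegral_congr_fun measurableSet_Ioo fun s hs => ?_
      simp only [hGdef, indicator_of_mem hs]
      rw [← integral_mul_const]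
      congr 1
      ext y
      ring
    rw [e1, e2] at htr
    simpa using htr
  have hvG : ∀ᵐ x ∂(volume.restrict (cylinder ω)), v x = prim G x.2 := by
    filter_upwards [hV, ae_cylinder_of_ae (ω := ω) hVG] with x h2 h3
    rw [h2, h3]
  have hGcyl := hω.integrable_snd hG
  have hg1 : Integrable (fun x => (g x).2) (volume.restrict (cylinder ω)) :=
    hg2.integrable one_le_two
  -- both `g.2` and `G` represent the weak derivative of `v` in the last variable
  have hgG : ∀ᵐ x ∂(volume.restrict (cylinder ω)), (g x).2 = G x.2 := by
    have key := hω.isOpen_cylinder.ae_eq_zero_of_integral_contDiff_smul_eq_zero (μ := volume)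
      (f := fun x => (g x).2 - G x.2)
      (IntegrableOn.locallyIntegrableOn (hg1.sub hGcyl)) (fun φ hφ hφc hφs => ?_)
    · filter_upwards [(ae_restrict_iff' hω.isOpen_cylinder.measurableSet).2 key] with x hx
      exact sub_eq_zero.1 hx
    · have hφt : IsTest (cylinder ω) φ := ⟨hφ, hφc, hφs⟩
      have hφh := hφt.mono cylinder_subset_halfCylinder
      have t1 := hv.trace.2 φ hφh
      have t2 := hω.integral_prim_mul_fderiv hG hφh
      rw [integral_congr_ae (g := fun x => prim G x.2 * fderiv ℝ φ x (0, 1))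
        (by filter_upwards [hvG] with x hx; rw [hx]), t2] at t1
      simp only [Pi.zero_apply, zero_mul, integral_zero, zero_sub, neg_inj] at t1
      rw [← setIntegral_eq_integral_of_forall_compl_eq_zero (s := cylinder ω) fun x hx => by
        rw [hφt.eq_zero hx, zero_smul]]
      simp only [smul_eq_mul, mul_comm (φ _), sub_mul]
      rw [integral_sub (hφt.integrable_mul hg1) (hφt.integrable_mul hGcyl), t1, sub_self]
  exact ⟨G, hG, hω.memLp_snd_iff.1 (hg2.ae_eq hgG), hvG, hgG⟩

end Cylinder

/-! ### Reduction of the weak equations to ordinary differential equations -/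

section Reduction

variable {ω : Set (EuclideanSpace ℝ (Fin d))} {f : ℝ → ℝ} {u : Space d → ℝ}

theorem integrableOn_Ioo_of_continuous {F : ℝ → ℝ} (hF : Continuous F) :
    IntegrableOn F (Ioo 0 1) :=
  (hF.integrableOn_Icc (a := 0) (b := 1)).mono_set Ioo_subset_Icc_self

theorem IsSmoothBoundedDomain.integrableOn_snd (hω : IsSmoothBoundedDomain ω) {F : ℝ → ℝ}
    (hF : Continuous F) : IntegrableOn (fun x : Space d => F x.2) (cylinder ω) := by
  have := hω.isFiniteMeasure
  rw [IntegrableOn, volume_restrict_cylinder]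
  exact (integrableOn_Ioo_of_continuous hF).comp_snd _

/-- The Dirichlet form of gradients whose last components depend on `x_N` only. -/
theorem integral_dot_snd {g h : Space d → Space d} {G H : ℝ → ℝ}
    (hg : ∀ᵐ x ∂(volume.restrict (cylinder ω)), (g x).2 = G x.2)
    (hh : ∀ᵐ x ∂(volume.restrict (cylinder ω)), (h x).2 = H x.2)
    (h1 : ∀ x, inner ℝ (g x).1 (h x).1 = 0) :
    ∫ x in cylinder ω, dot (g x) (h x) = volume.real ω * ∫ s in Ioo (0 : ℝ) 1, G s * H s := by
  rw [← integral_cylinder_snd]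
  refine integral_congr_ae ?_
  filter_upwards [hg, hh] with x e1 e2
  rw [dot, h1, e1, e2, zero_add]

/-- The regularity gained from the integrated equation. -/
theorem exists_C2_of_ae_eq_neg_integral {G p : ℝ → ℝ} (hp : Continuous p)
    (h : G =ᵐ[volume.restrict (Ioo 0 1)] fun t => - ∫ s in (0 : ℝ)..t, p s) :
    ∃ z y : ℝ → ℝ, (∀ t, HasDerivAt z (y t) t) ∧ (∀ t, HasDerivAt y (-p t) t) ∧ y 0 = 0 ∧
      z 1 = 0 ∧ ∀ t ∈ Icc (0 : ℝ) 1, z t = prim G t := by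
  have hy : ∀ t, HasDerivAt (fun t => - ∫ s in (0 : ℝ)..t, p s) (-p t) t := fun t =>
    (hp.integral_hasStrictDerivAt 0 t).hasDerivAt.neg
  have hyc : Continuous fun t => - ∫ s in (0 : ℝ)..t, p s :=
    continuous_iff_continuousAt.2 fun t => (hy t).continuousAt
  exact ⟨prim fun t => - ∫ s in (0 : ℝ)..t, p s, _,
    fun t => (hyc.integral_hasStrictDerivAt 1 t).hasDerivAt, hy, by simp, by simp,
    fun t ht => (prim_congr h ht).symm⟩

/-- A one-dimensional weak solution is a classical solution of `U'' = - f(U)`, `U' 0 = U 1 = 0`. -/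
theorem IsSmoothBoundedDomain.exists_ode_solution (hω : IsSmoothBoundedDomain ω)
    (hf : Continuous f) {U : ℝ → ℝ} (hu : IsWeakSolution f ω u)
    (hcont : ContinuousOn u (cylinder ω)) (hone : ∀ x ∈ cylinder ω, u x = U x.2) :
    ∃ W Y : ℝ → ℝ, (∀ t, HasDerivAt W (Y t) t) ∧ Continuous Y ∧
      (∀ t ∈ Ioo (0 : ℝ) 1, HasDerivAt Y (-f (W t)) t) ∧ Y 0 = 0 ∧ W 1 = 0 ∧
      ∀ t ∈ Ioo (0 : ℝ) 1, U t = W t := by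
  obtain ⟨g, hg, heq⟩ := hu
  have hae : ∀ᵐ x ∂(volume.restrict (cylinder ω)), u x = U x.2 :=
    (ae_restrict_iff' hω.isOpen_cylinder.measurableSet).2 (.of_forall hone)
  obtain ⟨G, hG, hG2, huG, hgG⟩ := hω.exists_prim hg ⟨U, hae⟩
  have hc := continuous_prim hG
  have hfc : Continuous fun t => f (prim G t) := hf.comp hc
  have hGeq := ae_eq_neg_integral hG hG2 hfc fun H hH hH2 => by
    have h1 := (heq _ _ (hω.inH10_prim hH hH2)).2
    rw [integral_dot_snd hgG (.of_forall fun _ => rfl) (by simp),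
      integral_congr_ae (g := fun x : Space d => f (prim G x.2) * prim H x.2)
        (by filter_upwards [huG] with x hx; rw [hx]),
      integral_cylinder_snd ω fun s => f (prim G s) * prim H s, ← mul_sub] at h1
    exact sub_eq_zero.1 ((mul_eq_zero.1 h1).resolve_left hω.measureReal_pos.ne')
  obtain ⟨W, Y, hW, hY, hY0, hW1, hWG⟩ := exists_C2_of_ae_eq_neg_integral hfc hGeq
  refine ⟨W, Y, hW, continuous_iff_continuousAt.2 fun t => (hY t).continuousAt, fun t ht => ?_,
    hY0, hW1, fun t ht => ?_⟩
  · rw [hWG t (Ioo_subset_Icc_self ht)]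
    exact hY t
  · rw [hWG t (Ioo_subset_Icc_self ht)]
    obtain ⟨y, hy⟩ := hω.isConnected.nonempty
    have hUc : ContinuousOn U (Ioo 0 1) := by
      have h1 : ContinuousOn (fun t => u (y, t)) (Ioo 0 1) :=
        hcont.comp (Continuous.prodMk_right y).continuousOn fun t ht => ⟨hy, ht⟩
      exact h1.congr fun t ht => (hone (y, t) ⟨hy, ht⟩).symm
    have hUG : U =ᵐ[volume.restrict (Ioo 0 1)] prim G := by
      refine hω.ae_of_ae_cylinder (P := fun t => U t = prim G t) ?_
      filter_upwards [hae, huG] with x h1 h2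
      rw [← h1, h2]
    exact Measure.eqOn_open_of_ae_eq hUG isOpen_Ioo hUc hc.continuousOn ht

variable {W : ℝ → ℝ} {α : ℝ} {φ : Space d → ℝ}

/-- One-dimensional weak eigenfunctions are classical solutions of the linearized equation. -/
theorem IsSmoothBoundedDomain.exists_sol_of_isOneDimEigen (hω : IsSmoothBoundedDomain ω)
    (hf : ContDiff ℝ 1 f) (hW : Continuous W) (hu : ∀ x ∈ cylinder ω, u x = W x.2)
    (h : IsOneDimEigen f ω u α φ) :
    ∃ z y : ℝ → ℝ, IsSol (fun t => deriv f (W t) + α) z y ∧ y 0 = 0 ∧ z 1 = 0 ∧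
      ∀ᵐ x ∂(volume.restrict (cylinder ω)), φ x = z x.2 := by
  obtain ⟨h1, g, hg, heq⟩ := h
  have hae : ∀ᵐ x ∂(volume.restrict (cylinder ω)), u x = W x.2 :=
    (ae_restrict_iff' hω.isOpen_cylinder.measurableSet).2 (.of_forall hu)
  obtain ⟨G, hG, hG2, hφG, hgG⟩ := hω.exists_prim hg h1
  have hc := continuous_prim hG
  have hqc : Continuous fun t => deriv f (W t) := (hf.continuous_deriv le_rfl).comp hW
  have hpc : Continuous fun t => (deriv f (W t) + α) * prim G t := by fun_prop
  have hGeq := ae_eq_neg_integral hG hG2 hpc fun H hH hH2 => by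
    have h1 := (heq _ _ (hω.inH10_prim hH hH2) ⟨prim H, .of_forall fun _ => rfl⟩).2
    have hHc := continuous_prim hH
    have i1 : IntegrableOn (fun s => deriv f (W s) * prim G s * prim H s) (Ioo 0 1) :=
      integrableOn_Ioo_of_continuous (by fun_prop)
    have i2 : IntegrableOn (fun s => α * (prim G s * prim H s)) (Ioo 0 1) :=
      integrableOn_Ioo_of_continuous (by fun_prop)
    rw [integral_dot_snd hgG (.of_forall fun _ => rfl) (by simp),
      integral_congr_ae (g := fun x : Space d => deriv f (W x.2) * prim G x.2 * prim H x.2)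
        (by filter_upwards [hφG, hae] with x hx hx'; rw [hx, hx']),
      integral_congr_ae (f := fun x : Space d => φ x * prim H x.2)
        (g := fun x : Space d => prim G x.2 * prim H x.2)
        (by filter_upwards [hφG] with x hx; rw [hx]),
      integral_cylinder_snd ω fun s => deriv f (W s) * prim G s * prim H s,
      integral_cylinder_snd ω fun s => prim G s * prim H s] at h1
    have e : ∀ s, (deriv f (W s) + α) * prim G s * prim H s =
        deriv f (W s) * prim G s * prim H s + α * (prim G s * prim H s) := fun s => by ring
    simp only [e]
    rw [integral_add i1 i2, integral_const_mul]
    refine mul_left_cancel₀ hω.measureReal_pos.ne' ?_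
    linear_combination h1
  obtain ⟨z, y, hz, hy, hy0, hz1, hzG⟩ := exists_C2_of_ae_eq_neg_integral hpc hGeq
  refine ⟨z, y, ⟨fun t _ => (hz t).continuousAt.continuousWithinAt,
    fun t _ => (hy t).continuousAt.continuousWithinAt, fun t _ => hz t, fun t ht => ?_⟩, hy0, hz1,
    ?_⟩
  · rw [hzG t (Ioo_subset_Icc_self ht)]
    exact hy t
  · have : ∀ᵐ s ∂(volume.restrict (Ioo (0 : ℝ) 1)), z s = prim G s :=
      (ae_restrict_iff' measurableSet_Ioo).2
        (.of_forall fun t ht => hzG t (Ioo_subset_Icc_self ht))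
    filter_upwards [hφG, ae_cylinder_of_ae (ω := ω) this] with x e1 e2
    rw [e1, e2]

/-- Classical solutions of the linearized equation are weak eigenfunctions. -/
theorem IsSmoothBoundedDomain.isOneDimEigen_of_deriv (hω : IsSmoothBoundedDomain ω)
    (hf : ContDiff ℝ 1 f) (hW : Continuous W) (hu : ∀ x ∈ cylinder ω, u x = W x.2) {z y : ℝ → ℝ}
    (hz : ∀ t ∈ Icc (0 : ℝ) 1, HasDerivAt z (y t) t)
    (hy : ∀ t ∈ Icc (0 : ℝ) 1, HasDerivAt y (-((deriv f (W t) + α) * z t)) t)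
    (hy0 : y 0 = 0) (hz1 : z 1 = 0) : IsOneDimEigen f ω u α fun x => z x.2 := by
  have hae : ∀ᵐ x ∂(volume.restrict (cylinder ω)), u x = W x.2 :=
    (ae_restrict_iff' hω.isOpen_cylinder.measurableSet).2 (.of_forall hu)
  have hyc : ContinuousOn y (Icc 0 1) := fun t ht => (hy t ht).continuousAt.continuousWithinAt
  have hzc : ContinuousOn z (Icc 0 1) := fun t ht => (hz t ht).continuousAt.continuousWithinAt
  have hqc : Continuous fun t => deriv f (W t) := (hf.continuous_deriv le_rfl).comp hW
  -- `z` is the function `prim G` on `[0, 1]`, where `G` is `z'` cut off outside `[0, 1]`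
  set G : ℝ → ℝ := (Icc (0 : ℝ) 1).indicator y with hGdef
  have hGy : ∀ t ∈ Icc (0 : ℝ) 1, G t = y t := fun t ht => indicator_of_mem ht _
  have hG : Integrable G :=
    (integrable_indicator_iff measurableSet_Icc).2 hyc.integrableOn_Icc
  have hG2 : MemLp G 2 (volume.restrict (Ioo 0 1)) := by
    obtain ⟨C, hC⟩ := isCompact_Icc.exists_bound_of_continuousOn hyc
    refine MemLp.of_bound hG.aestronglyMeasurable.restrict C
      ((ae_restrict_iff' measurableSet_Ioo).2 (.of_forall fun t ht => ?_))
    rw [hGy t (Ioo_subset_Icc_self ht)]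
    exact hC t (Ioo_subset_Icc_self ht)
  have hzG : ∀ t ∈ Icc (0 : ℝ) 1, prim G t = z t := fun t ht => by
    have hsub : uIcc 1 t ⊆ Icc (0 : ℝ) 1 := by
      rw [uIcc_of_ge ht.2]
      exact Icc_subset_Icc_left ht.1
    have := intervalIntegral.integral_eq_sub_of_hasDerivAt (f := z) (f' := y)
      (fun s hs => hz s (hsub hs)) (hyc.mono hsub).intervalIntegrable
    rw [hz1, sub_zero] at this
    rw [← this]
    exact intervalIntegral.integral_congr fun s hs => hGy s (hsub hs)
  have hzGae : ∀ᵐ x ∂(volume.restrict (cylinder ω)), prim G x.2 = z x.2 :=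
    (ae_restrict_iff' hω.isOpen_cylinder.measurableSet).2
      (.of_forall fun x hx => hzG x.2 (Ioo_subset_Icc_self hx.2))
  refine IsOneDimEigen.congr ?_ hzGae
  have hc := continuous_prim hG
  refine ⟨⟨prim G, .of_forall fun _ => rfl⟩, _, hω.inH10_prim hG hG2, fun v h hv hv1 => ?_⟩
  obtain ⟨H, hH, hH2, hvH, hhH⟩ := hω.exists_prim hv hv1
  have hHc := continuous_prim hH
  have e1 : (fun x : Space d => deriv f (W x.2) * prim G x.2 * prim H x.2)
      =ᵐ[volume.restrict (cylinder ω)] fun x => deriv f (u x) * prim G x.2 * v x := by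
    filter_upwards [hae, hvH] with x h1 h2
    rw [h1, h2]
  have e2 : (fun x : Space d => prim G x.2 * prim H x.2)
      =ᵐ[volume.restrict (cylinder ω)] fun x => prim G x.2 * v x := by
    filter_upwards [hvH] with x h2
    rw [h2]
  refine ⟨(hω.integrableOn_snd (F := fun s => deriv f (W s) * prim G s * prim H s)
    (by fun_prop)).congr e1, ?_⟩
  rw [integral_dot_snd (G := G) (.of_forall fun _ => rfl) hhH (by simp), ← integral_congr_ae e1,
    ← integral_congr_ae e2, integral_cylinder_snd ω fun s => deriv f (W s) * prim G s * prim H s,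
    integral_cylinder_snd ω fun s => prim G s * prim H s]
  have key := integral_mul_prim hy (by fun_prop) hy0 hH
  have i1 : IntegrableOn (fun s => deriv f (W s) * prim G s * prim H s) (Ioo 0 1) :=
    integrableOn_Ioo_of_continuous (by fun_prop)
  have i2 : IntegrableOn (fun s => α * (prim G s * prim H s)) (Ioo 0 1) :=
    integrableOn_Ioo_of_continuous (by fun_prop)
  have e3 : ∫ s in Ioo (0 : ℝ) 1, prim H s * -((deriv f (W s) + α) * z s) =
      - ((∫ s in Ioo (0 : ℝ) 1, deriv f (W s) * prim G s * prim H s) +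
        α * ∫ s in Ioo (0 : ℝ) 1, prim G s * prim H s) := by
    rw [← integral_const_mul, ← integral_add i1 i2, ← integral_neg]
    refine setIntegral_congr_fun measurableSet_Ioo fun s hs => ?_
    simp only [hzG s (Ioo_subset_Icc_self hs)]
    ring
  have e4 : ∫ s in Ioo (0 : ℝ) 1, H s * y s = ∫ s in Ioo (0 : ℝ) 1, G s * H s :=
    setIntegral_congr_fun measurableSet_Ioo fun s hs => by
      simp only [hGy s (Ioo_subset_Icc_self hs)]
      ring
  rw [e3, e4] at key
  linear_combination volume.real ω * key

variable {θ : ℝ → ℝ}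

/-- The solutions with `z' 0 = 0` are the multiples of the one of angle `π / 2` at `0`. -/
theorem IsSol.eq_mul_of_angle {p R z y : ℝ → ℝ} (hp : Continuous p) (hz : IsSol p z y)
    (hy0 : y 0 = 0) (hθ : IsAngle p θ) (hθ0 : θ 0 = Real.pi / 2) (hR : IsRadius p θ R) :
    ∀ t ∈ Icc (0 : ℝ) 1, z t = z 0 * (R t * Real.sin (θ t)) := fun t ht => by
  have := (hz.polar hp hθ hR (by simp [hθ0, hy0]) ht).1
  simpa [hθ0] using this

/-- The eigenspaces are at most one-dimensional, and the eigenvalues are found by shooting. -/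
theorem IsSmoothBoundedDomain.toENat_rank_oneDimEigenspace (hω : IsSmoothBoundedDomain ω)
    (hf : ContDiff ℝ 1 f) (hW : Continuous W) (hu : ∀ x ∈ cylinder ω, u x = W x.2)
    (hθ : IsAngle (fun t => deriv f (W t) + α) θ) (hθ0 : θ 0 = Real.pi / 2) :
    Cardinal.toENat (Module.rank ℝ (oneDimEigenspace f ω u α)) =
      if Real.sin (θ 1) = 0 then 1 else 0 := by
  have hpc : Continuous fun t => deriv f (W t) + α :=
    ((hf.continuous_deriv le_rfl).comp hW).add continuous_const
  obtain ⟨R, hR⟩ := hθ.exists_isRadius hpc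
  set Z : ℝ → ℝ := fun t => R t * Real.sin (θ t) with hZ
  have hform : ∀ φ ∈ oneDimEigenspace f ω u α, ∃ c : ℝ, c * Z 1 = 0 ∧
      ∀ᵐ x ∂(volume.restrict (cylinder ω)), φ x = c * Z x.2 := fun φ hφ => by
    obtain ⟨z, y, hz, hy0, hz1, hφz⟩ := hω.exists_sol_of_isOneDimEigen hf hW hu hφ
    have hzZ := hz.eq_mul_of_angle hpc hy0 hθ hθ0 hR
    refine ⟨z 0, by rw [← hzZ 1 (by simp), hz1], ?_⟩
    filter_upwards [hφz, ae_restrict_mem hω.isOpen_cylinder.measurableSet] with x h1 h2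
    rw [h1, hzZ x.2 (Ioo_subset_Icc_self h2.2)]
  -- `Z` is the solution with `Z 0 = 1`, `Z' 0 = 0`; it spans the eigenspace if `Z 1 = 0`
  by_cases hs : Real.sin (θ 1) = 0
  · have hE : IsOneDimEigen f ω u α fun x => Z x.2 :=
      hω.isOneDimEigen_of_deriv hf hW hu (fun t ht => hR.hasDerivAt_sin hθ ht)
        (fun t ht => hR.hasDerivAt_cos hθ ht) (by simp [hθ0]) (by simp [hZ, hs])
    have hZ2 : MemLp (fun x : Space d => Z x.2) 2 (volume.restrict (cylinder ω)) := by
      obtain ⟨_, g, hg, _⟩ := hE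
      exact hg.memLp
    have hZc : ContinuousOn Z (Icc 0 1) := fun t ht =>
      (hR.hasDerivAt_sin hθ ht).continuousAt.continuousWithinAt
    have hrank : Module.rank ℝ (oneDimEigenspace f ω u α) = 1 := by
      rw [rank_submodule_eq_one_iff]
      refine ⟨hZ2.toLp, hE.congr hZ2.coeFn_toLp.symm, fun h0 => ?_, fun φ hφ => ?_⟩
      · have h1 : ∀ᵐ x ∂(volume.restrict (cylinder ω)), Z x.2 = 0 := by
          have h2 := hZ2.coeFn_toLp
          rw [h0] at h2
          filter_upwards [h2, Lp.coeFn_zero ℝ 2 (volume.restrict (cylinder ω))] with x e1 e2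
          rw [← e1, e2]
          rfl
        have h2 : EqOn Z 0 (Ioo 0 1) := Measure.eqOn_open_of_ae_eq (hω.ae_of_ae_cylinder h1)
          isOpen_Ioo (hZc.mono Ioo_subset_Icc_self) continuousOn_const
        have h3 : ∀ᶠ t in nhdsWithin (0 : ℝ) (Ioi 0), Z t ≠ 0 :=
          ((hR.hasDerivAt_sin hθ (by simp)).continuousAt.eventually_ne
            (by simp [hθ0, hR.zero])).filter_mono nhdsWithin_le_nhds
        obtain ⟨t, ht1, ht2⟩ := (h3.and (Ioo_mem_nhdsGT zero_lt_one)).exists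
        exact ht1 (h2 ht2)
      · obtain ⟨c, -, hc⟩ := hform φ hφ
        refine Submodule.mem_span_singleton.2 ⟨c, ?_⟩
        apply Lp.ext
        filter_upwards [hc, hZ2.coeFn_toLp, Lp.coeFn_smul c hZ2.toLp] with x e1 e2 e3
        rw [e1, e3, Pi.smul_apply, e2, smul_eq_mul]
    rw [hrank, if_pos hs]
    simp
  · have hbot : oneDimEigenspace f ω u α = ⊥ := by
      rw [Submodule.eq_bot_iff]
      intro φ hφ
      obtain ⟨c, hc1, hc⟩ := hform φ hφ
      have hc0 : c = 0 := by
        simpa [hZ, hs, (hR.pos 1).ne'] using hc1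
      apply Lp.ext
      filter_upwards [hc, Lp.coeFn_zero ℝ 2 (volume.restrict (cylinder ω))] with x e1 e2
      rw [e1, e2, hc0, zero_mul]
      rfl
    rw [hbot, if_neg hs, rank_bot, map_zero]

/-- The classical eigenvalues are found by shooting from `0`. -/
theorem isODEEigenvalue_iff {U : ℝ → ℝ} (hf : ContDiff ℝ 1 f) (hW : Continuous W)
    (hUW : ∀ t ∈ Ioo (0 : ℝ) 1, U t = W t)
    (hθ : IsAngle (fun t => deriv f (W t) + α) θ) (hθ0 : θ 0 = Real.pi / 2) :
    IsODEEigenvalue f U α ↔ Real.sin (θ 1) = 0 := by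
  have hpc : Continuous fun t => deriv f (W t) + α :=
    ((hf.continuous_deriv le_rfl).comp hW).add continuous_const
  obtain ⟨R, hR⟩ := hθ.exists_isRadius hpc
  have hun := uniqueDiffOn_Icc (zero_lt_one (α := ℝ))
  constructor
  · rintro ⟨z, hz2, hode, hz0, hz1, s, hs, hzs⟩
    have hD : ∀ t ∈ Ioo (0 : ℝ) 1, ∀ᶠ r in nhds t, derivWithin z (Icc 0 1) r = deriv z r :=
      fun t ht => by
        filter_upwards [Ioo_mem_nhds ht.1 ht.2] with r hr
        exact derivWithin_of_mem_nhds (Icc_mem_nhds hr.1 hr.2)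
    have h1 : ContDiffOn ℝ 1 (derivWithin z (Icc 0 1)) (Icc 0 1) :=
      hz2.derivWithin hun (by norm_num)
    have hsol : IsSol (fun t => deriv f (W t) + α) z (derivWithin z (Icc 0 1)) := by
      refine ⟨hz2.continuousOn, h1.continuousOn, fun t ht => ?_, fun t ht => ?_⟩
      · exact ((hz2.differentiableOn (by norm_num) t
          (Ioo_subset_Icc_self ht)).hasDerivWithinAt).hasDerivAt (Icc_mem_nhds ht.1 ht.2)
      · have h2 := ((h1.differentiableOn (by norm_num) t
          (Ioo_subset_Icc_self ht)).differentiableAt (Icc_mem_nhds ht.1 ht.2)).hasDerivAt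
        rw [Filter.EventuallyEq.deriv_eq (hD t ht)] at h2
        convert! h2 using 1
        have := hode t ht
        rw [hUW t ht] at this
        linear_combination this
    have hzZ := hsol.eq_mul_of_angle hpc hz0 hθ hθ0 hR
    have hne : z 0 ≠ 0 := fun h0 => hzs (by rw [hzZ s (Ioo_subset_Icc_self hs), h0, zero_mul])
    have := hzZ 1 (by simp)
    rw [hz1] at this
    simpa [hne, (hR.pos 1).ne'] using this.symm
  · intro hs
    have hz : ∀ t ∈ Icc (0 : ℝ) 1, HasDerivAt (fun t => R t * Real.sin (θ t))
      (R t * Real.cos (θ t)) t := fun t ht => hR.hasDerivAt_sin hθ ht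
    have hy : ∀ t ∈ Icc (0 : ℝ) 1, HasDerivAt (fun t => R t * Real.cos (θ t))
      (-((deriv f (W t) + α) * (R t * Real.sin (θ t)))) t := fun t ht => hR.hasDerivAt_cos hθ ht
    have hdz : ∀ t ∈ Icc (0 : ℝ) 1, derivWithin (fun t => R t * Real.sin (θ t)) (Icc 0 1) t =
      R t * Real.cos (θ t) := fun t ht => (hz t ht).hasDerivWithinAt.derivWithin (hun t ht)
    refine ⟨fun t => R t * Real.sin (θ t), ?_, fun s hs => ?_, ?_, by simp [hs], ?_⟩
    · rw [show (2 : WithTop ℕ∞) = 1 + 1 from by norm_num, contDiffOn_succ_iff_derivWithin hun]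
      refine ⟨fun t ht => (hz t ht).differentiableAt.differentiableWithinAt, by simp, ?_⟩
      refine ContDiffOn.congr ?_ hdz
      rw [contDiffOn_one_iff_derivWithin hun]
      refine ⟨fun t ht => (hy t ht).differentiableAt.differentiableWithinAt, ?_⟩
      refine ContinuousOn.congr ?_ fun t ht => (hy t ht).hasDerivWithinAt.derivWithin (hun t ht)
      exact (hpc.continuousOn.mul fun t ht => (hz t ht).continuousAt.continuousWithinAt).neg
    · have hev : deriv (fun t => R t * Real.sin (θ t)) =ᶠ[nhds s] fun t => R t * Real.cos (θ t) := by
        filter_upwards [Ioo_mem_nhds hs.1 hs.2] with r hr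
        exact (hz r (Ioo_subset_Icc_self hr)).deriv
      rw [hev.deriv_eq, (hy s (Ioo_subset_Icc_self hs)).deriv, hUW s hs]
      ring
    · rw [hdz 0 (by simp), hθ0]
      simp
    · have h3 : ∀ᶠ t in nhdsWithin (0 : ℝ) (Ioi 0), R t * Real.sin (θ t) ≠ 0 :=
        ((hz 0 (by simp)).continuousAt.eventually_ne
          (by simp [hθ0, hR.zero])).filter_mono nhdsWithin_le_nhds
      obtain ⟨t, ht1, ht2⟩ := (h3.and (Ioo_mem_nhdsGT zero_lt_one)).exists
      exact ⟨t, ht2, ht1⟩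

end Reduction

/-! ### Nodal domains -/

section Nodal

variable {ω : Set (EuclideanSpace ℝ (Fin d))}

/-- The slab of the cylinder in which the angle `φ` lies strictly between `k π` and `(k + 1) π`. -/
def nodalSlab (ω : Set (EuclideanSpace ℝ (Fin d))) (φ : ℝ → ℝ) (k : ℕ) : Set (Space d) :=
  ω ×ˢ {s ∈ Ioo (0 : ℝ) 1 | k * Real.pi < φ s ∧ φ s < (k + 1) * Real.pi}

variable {p φ : ℝ → ℝ}

theorem IsAngle.ordConnected_nodal (h : IsAngle p φ) (hp : Continuous p) (k : ℕ) :
    OrdConnected {s ∈ Ioo (0 : ℝ) 1 | k * Real.pi < φ s ∧ φ s < (k + 1) * Real.pi} := by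
  refine ⟨fun s hs t ht r hr => ?_⟩
  have hr0 : 0 < r := hs.1.1.trans_le hr.1
  have hr1 : r < 1 := hr.2.trans_lt ht.1.2
  refine ⟨⟨hr0, hr1⟩, ?_, ?_⟩
  · rcases hr.1.eq_or_lt with rfl | hlt
    · exact hs.2.1
    · exact_mod_cast h.lt_of_int_mul_pi_le hp k hs.1.1.le hlt hr1.le
        (by exact_mod_cast hs.2.1.le)
  · rcases hr.2.eq_or_lt with rfl | hlt
    · exact ht.2.2
    · by_contra hcon
      have := h.lt_of_int_mul_pi_le hp (k + 1) hr0.le hlt ht.1.2.le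
        (by push_cast; exact not_lt.1 hcon)
      push_cast at this
      exact lt_asymm this ht.2.2

/-- The nodal domains are the slabs cut out by the values `k π` of the angle. -/
theorem IsSmoothBoundedDomain.encard_nodalDomains (hω : IsSmoothBoundedDomain ω)
    (h : IsAngle p φ) (hp : Continuous p) (hφ0 : φ 0 = Real.pi / 2) {m : ℕ}
    (hm : φ 1 = m * Real.pi) {u : Space d → ℝ}
    (hu : ∀ x ∈ cylinder ω, u x = 0 ↔ Real.sin (φ x.2) = 0) :
    (nodalDomains ω u).encard = m := by
  have hπ := Real.pi_pos
  set F : Set (Space d) := cylinder ω \ {y | u y = 0} with hF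
  have hFcyl : F ⊆ cylinder ω := sdiff_subset
  have hsin : ∀ x ∈ F, ∀ k : ℤ, φ x.2 ≠ k * Real.pi := fun x hx k hk =>
    hx.2 ((hu x hx.1).2 (by rw [hk, Real.sin_int_mul_pi]))
  have hsub : ∀ k, nodalSlab ω φ k ⊆ F := fun k x hx => by
    have hxc : x ∈ cylinder ω := ⟨hx.1, hx.2.1⟩
    refine ⟨hxc, fun h0 => ?_⟩
    obtain ⟨l, hl⟩ := Real.sin_eq_zero_iff.1 ((hu x hxc).1 h0)
    obtain ⟨h1, h2⟩ := hx.2.2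
    rw [← hl] at h1 h2
    have h3 : (k : ℤ) < l := by exact_mod_cast lt_of_mul_lt_mul_right h1 hπ.le
    have h4 : l < (k : ℤ) + 1 := by exact_mod_cast lt_of_mul_lt_mul_right h2 hπ.le
    omega
  have hcover : ∀ x ∈ F, ∃ k < m, x ∈ nodalSlab ω φ k := fun x hx => by
    have hx2 : x.2 ∈ Ioo (0 : ℝ) 1 := hx.1.2
    have hpos : 0 < φ x.2 := by
      have := h.lt_of_int_mul_pi_le hp 0 le_rfl hx2.1 hx2.2.le
        (by rw [hφ0]; simpa using (half_pos hπ).le)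
      simpa using this
    have hlt : φ x.2 < m * Real.pi := by
      by_contra hcon
      have := h.lt_of_int_mul_pi_le hp m hx2.1.le hx2.2 le_rfl
        (by push_cast; exact not_lt.1 hcon)
      push_cast at this
      exact this.ne' hm
    have h1 : (⌊φ x.2 / Real.pi⌋₊ : ℝ) ≤ φ x.2 / Real.pi := Nat.floor_le (by positivity)
    have h2 : φ x.2 / Real.pi < ⌊φ x.2 / Real.pi⌋₊ + 1 := Nat.lt_floor_add_one _
    rw [le_div_iff₀ hπ] at h1
    rw [div_lt_iff₀ hπ] at h2
    refine ⟨⌊φ x.2 / Real.pi⌋₊, ?_, hx.1.1, hx2, lt_of_le_of_ne h1 ?_, h2⟩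
    · exact_mod_cast lt_of_mul_lt_mul_right (h1.trans_lt hlt) hπ.le
    · have := hsin x hx ⌊φ x.2 / Real.pi⌋₊
      exact_mod_cast this.symm
  have hne : ∀ k < m, (nodalSlab ω φ k).Nonempty := fun k hk => by
    obtain ⟨y, hy⟩ := hω.isConnected.nonempty
    have hk1 : ((k : ℝ) + 1) * Real.pi ≤ m * Real.pi :=
      mul_le_mul_of_nonneg_right (by exact_mod_cast hk) hπ.le
    have hk0 : 0 ≤ (k : ℝ) * Real.pi := by positivity
    -- the value `(k + 3/4) π` is distinct from the boundary values `π / 2` and `m π`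
    obtain ⟨s, hs, hsk⟩ := intermediate_value_Ioo (zero_le_one (α := ℝ)) h.continuousOn
      (show (k + 3 / 4) * Real.pi ∈ Ioo (φ 0) (φ 1) from
        ⟨by rw [hφ0]; linarith, by rw [hm]; linarith⟩)
    exact ⟨(y, s), hy, hs, by simp only [hsk]; linarith, by simp only [hsk]; linarith⟩
  have hcomp : ∀ k, ∀ x ∈ nodalSlab ω φ k, connectedComponentIn F x = nodalSlab ω φ k := by
    intro k x hx
    refine Subset.antisymm (fun y hy => ?_) ?_
    · have hCF := connectedComponentIn_subset F x
      have hJ : OrdConnected ((fun z : Space d => φ z.2) '' connectedComponentIn F x) := by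
        refine (isPreconnected_connectedComponentIn.image _ ?_).ordConnected
        exact h.continuousOn.comp continuous_snd.continuousOn fun z hz =>
          Ioo_subset_Icc_self (hFcyl (hCF hz)).2
      have hxC := mem_connectedComponentIn (hsub k hx)
      have hnot : ∀ l : ℤ, (l : ℝ) * Real.pi ∉
          (fun z : Space d => φ z.2) '' connectedComponentIn F x := by
        rintro l ⟨z, hz, hzl⟩
        exact hsin z (hCF hz) l hzl
      have hyc := hFcyl (hCF hy)
      refine ⟨hyc.1, hyc.2, ?_, ?_⟩
      · by_contra hcon
        refine hnot k (hJ.out (mem_image_of_mem _ hy) (mem_image_of_mem _ hxC) ⟨?_, ?_⟩)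
        · exact_mod_cast not_lt.1 hcon
        · exact_mod_cast hx.2.2.1.le
      · by_contra hcon
        refine hnot (k + 1) (hJ.out (mem_image_of_mem _ hxC) (mem_image_of_mem _ hy) ⟨?_, ?_⟩)
        · push_cast
          exact hx.2.2.2.le
        · push_cast
          exact not_lt.1 hcon
    · exact (hω.isConnected.isPreconnected.prod
        (h.ordConnected_nodal hp k).isPreconnected).subset_connectedComponentIn hx (hsub k)
  have himage : nodalDomains ω u = nodalSlab ω φ '' Iio m := by
    ext C
    constructor
    · rintro ⟨x, hx, rfl⟩
      obtain ⟨k, hk, hxk⟩ := hcover x hx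
      exact ⟨k, hk, (hcomp k x hxk).symm⟩
    · rintro ⟨k, hk, rfl⟩
      obtain ⟨x, hx⟩ := hne k hk
      exact ⟨x, hsub k hx, (hcomp k x hx).symm⟩
  have hinj : InjOn (nodalSlab ω φ) (Iio m) := fun k hk l _ hkl => by
    obtain ⟨x, hx⟩ := hne k hk
    have hx' : x ∈ nodalSlab ω φ l := hkl ▸ hx
    have h1 := lt_of_mul_lt_mul_right (hx.2.2.1.trans hx'.2.2.2) hπ.le
    have h2 := lt_of_mul_lt_mul_right (hx'.2.2.1.trans hx.2.2.2) hπ.le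
    have h3 : k < l + 1 := by exact_mod_cast h1
    have h4 : l < k + 1 := by exact_mod_cast h2
    omega
  rw [himage, hinj.encard_image, ← Finset.coe_Iio, encard_coe_eq_coe_finsetCard, Nat.card_Iio]

end Nodal

/-! ### The Morse index -/

theorem tsum_subtype_ite_eq_encard {s : Set ℝ} {P : ℝ → Prop} [DecidablePred P] {n : ℕ}
    (h : {a | a ∈ s ∧ P a}.encard = n) :
    ∑' a : s, (if P a then 1 else 0 : ℕ∞) = n := by
  have hfin : {a | a ∈ s ∧ P a}.Finite := finite_of_encard_eq_coe h
  rw [tsum_subtype s fun a => (if P a then 1 else 0 : ℕ∞), tsum_eq_sum (s := hfin.toFinset)]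
  · rw [Finset.sum_congr rfl (g := fun _ => 1) fun a ha => ?_]
    · rw [Finset.sum_const, nsmul_one, ← h, hfin.encard_eq_coe_toFinset_card]
    · have ha' := hfin.mem_toFinset.1 ha
      rw [indicator_of_mem ha'.1, if_pos ha'.2]
  · intro a ha
    by_cases has : a ∈ s
    · rw [indicator_of_mem has, if_neg fun hP => ha (hfin.mem_toFinset.2 ⟨has, hP⟩)]
    · rw [indicator_of_notMem has]

end OneDimMorse


end

theorem mainTheorem4 {d : ℕ} (hd : 1 ≤ d) (ω : Set (EuclideanSpace ℝ (Fin d)))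
    (hω : OneDimMorse.IsSmoothBoundedDomain ω)
    (α : NNReal) (hα0 : 0 < α) (hα1 : α < 1)
    (f : ℝ → ℝ) (hf : OneDimMorse.IsC1Holder α f)
    (hf1 : ∀ s : ℝ, s ≠ 0 → f s / s < deriv f s)
    (hf3 : ∀ s : ℝ, s ≠ 0 → 0 < s * f s)
    (u : OneDimMorse.Space d → ℝ) (U : ℝ → ℝ)
    (hu : OneDimMorse.IsWeakSolution f ω u)
    (hcont : ContinuousOn u (OneDimMorse.cylinder ω))
    (honeDim : ∀ x ∈ OneDimMorse.cylinder ω, u x = U x.2)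
    (n : ℕ) (hn : 1 ≤ n) (hnodal : (OneDimMorse.nodalDomains ω u).encard = n) :
    OneDimMorse.oneDimMorseIndex f ω u = n ∧
      {a : ℝ | a < 0 ∧ OneDimMorse.IsODEEigenvalue f U a}.encard = n := by
  have hfC := hf.1
  have hf0 := OneDimMorse.apply_zero_of_mul_pos hfC.continuous hf3
  -- `U` is unspecified outside `(0, 1)`; `W` is a `C¹` extension, with derivative `Y`
  obtain ⟨W, Y, hW, hYc, hY, hY0, hW1, hUW⟩ :=
    hω.exists_ode_solution hfC.continuous hu hcont honeDim
  have hWc : Continuous W := continuous_iff_continuousAt.2 fun t => (hW t).continuousAt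
  have huW : ∀ x ∈ OneDimMorse.cylinder ω, u x = W x.2 := fun x hx => by
    rw [honeDim x hx, hUW x.2 hx.2]
  have hpc : Continuous fun t => dslope f 0 (W t) :=
    (OneDimMorse.continuous_dslope_zero hfC).comp hWc
  have hqc : Continuous fun t => deriv f (W t) := (hfC.continuous_deriv le_rfl).comp hWc
  -- the angle `φ` of `W` itself
  obtain ⟨φ, hφ0, hφ⟩ := OneDimMorse.exists_isAngle hpc (Real.pi / 2)
  obtain ⟨R, hR⟩ := hφ.exists_isRadius hpc
  have hWpol := (OneDimMorse.isSol_dslope hf0 hWc.continuousOn hYc.continuousOn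
    (fun t _ => hW t) hY).eq_mul_of_angle hpc hY0 hφ hφ0 hR
  -- there is at least one nodal domain, so the solution is nontrivial
  have hW0 : W 0 ≠ 0 := by
    intro h0
    have hempty : OneDimMorse.nodalDomains ω u = ∅ := by
      rw [Set.eq_empty_iff_forall_notMem]
      rintro C ⟨x, hx, -⟩
      refine hx.2 ?_
      rw [Set.mem_ofPred_eq, huW x hx.1, hWpol x.2 (Set.Ioo_subset_Icc_self hx.1.2), h0, zero_mul]
    rw [hempty, Set.encard_empty] at hnodal
    have : n = 0 := by exact_mod_cast hnodal.symm
    omega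
  have hzero : ∀ t ∈ Set.Icc (0 : ℝ) 1, W t = 0 ↔ Real.sin (φ t) = 0 := fun t ht => by
    rw [hWpol t ht]
    simp [hW0, (hR.pos t).ne']
  have hφn : φ 1 = n * Real.pi := by
    obtain ⟨k, hk⟩ := Real.sin_eq_zero_iff.1 ((hzero 1 (by simp)).1 hW1)
    have hpos := hφ.pos_one hpc hφ0
    have hk0 : 0 < k := by
      rw [← hk] at hpos
      exact_mod_cast pos_of_mul_pos_left hpos Real.pi_pos.le
    lift k to ℕ using hk0.le
    have hcard := hω.encard_nodalDomains hφ hpc hφ0 (m := k) (by exact_mod_cast hk.symm)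
      (u := u) fun x hx => by rw [huW x hx, hzero x.2 (Set.Ioo_subset_Icc_self hx.2)]
    rw [hnodal] at hcard
    have : n = k := by exact_mod_cast hcard
    rw [this, ← hk]
    push_cast
    rfl
  -- the angles `θ a` of the linearized equation with spectral parameter `a`
  choose θ hθ0 hθ using fun a : ℝ => OneDimMorse.exists_isAngle
    (p := fun t => deriv f (W t) + a) (by fun_prop) (Real.pi / 2)
  obtain ⟨hlow, hupp⟩ := OneDimMorse.angle_linearized_bounds hfC hf1 hf3 hWc hYc.continuousOn
    (fun t _ => hW t) hY hY0 hW0 hφ hφ0 (θ := θ 0) (by simpa using hθ 0) (hθ0 0)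
  have hcount := OneDimMorse.encard_angle_one hqc hθ hθ0 (n := n) (by rwa [← hφn])
    (by rw [add_mul, one_mul, ← hφn]; exact hupp)
  constructor
  · rw [← OneDimMorse.tsum_subtype_ite_eq_encard (s := Set.Iio 0) hcount]
    exact tsum_congr fun a => hω.toENat_rank_oneDimEigenspace hfC hWc huW (hθ a) (hθ0 a)
  · rw [← hcount]
    congr 1
    ext a
    exact and_congr_right fun _ => OneDimMorse.isODEEigenvalue_iff hfC hWc hUW (hθ a) (hθ0 a)
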